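/- Let $k$ be a positive square-free integer. For $n\ge 1$ put $$R_k(n)=\sum_{\substack{p\le n,\ p\text{ prime}\\ (n-p,k)=1}}\mu^2(n-p)\log p,\qquad k_n=\frac{k}{(k,n)},$$ where $\mu$ is the Möbius function, with the convention $\mu(0)=0$, and $(a,b)$ is the greatest common divisor. Let $c=\prod_p\left(1-\frac1{p(p-1)}\right)$ be Artin's constant, and put $$A_k(n)=c\,n\prod_{p\mid n}\left(1+\frac1{p^2-p-1}\right)\prod_{q\mid k}\left(1-\frac{q-1}{q^2-q-1}\right),$$ where $p$ and $q$ run over primes. (a) Suppose that $k$ is odd. Then, as $n\to\infty$ through the positive integers, $$\frac{R_k(n)}{n}\sim\frac{A_{k_n}(n)}{n},\qquad\text{where}\qquad \frac{A_{k_n}(n)}{n}=c\prod_{p\mid n}\left(1+\frac1{p^2-p-1}\right)\prod_{q\mid k_n}\left(1-\frac{q-1}{q^2-q-1}\right)>0$$ for every $n\ge1$. Moreover, there is $n_k>0$ such that $R_k(n)>0$ for all $n>n_k$. (b) Suppose that $k$ is even. Then, as $n\to\infty$ through the positive integers, $$\frac{R_k(2n)}{2n}\sim\frac{A_{k_{2n}}(2n)}{2n},\qquad\text{where}\qquad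 \frac{A_{k_{2n}}(2n)}{2n}=c\prod_{p\mid 2n}\left(1+\frac1{p^2-p-1}\right)\prod_{q\mid k_{2n}}\left(1-\frac{q-1}{q^2-q-1}\right)>0$$ for every $n\ge1$. Moreover, there is $n_k>0$ such that $R_k(n)>0$ for all even $n>n_k$. -/

import Mathlib

open Filter Asymptotics
open scoped ArithmeticFunction.Moebius

/-- `R_k(n) = ∑ μ²(n - p) log p`, over the primes `p ≤ n` with `gcd(n - p, k) = 1`. -/
noncomputable def primeSquarefreeCount (k n : ℕ) : ℝ :=
  ∑ p ∈ Finset.range (n + 1) with p.Prime ∧ Nat.gcd (n - p) k = 1,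
    (μ (n - p) : ℝ) ^ 2 * Real.log p

/-- Artin's constant `c = ∏_p (1 - 1 / (p (p - 1)))`, the product over all primes. -/
noncomputable def artinConstant : ℝ :=
  ∏' p : Nat.Primes, (1 - 1 / ((p : ℝ) * ((p : ℝ) - 1)))

/-- The product defining Artin's constant converges, so its value is not a default value. -/
theorem hasProd_artinConstant :
    HasProd (fun p : Nat.Primes => 1 - 1 / ((p : ℝ) * ((p : ℝ) - 1))) artinConstant := by
  have h2 : Summable (fun p : Nat.Primes => 2 * (1 / ((p : ℕ) : ℝ) ^ 2)) :=
    ((Real.summable_one_div_nat_pow.mpr one_lt_two).comp_injective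
      Nat.Primes.coe_nat_injective).mul_left 2
  have hs : Summable (fun p : Nat.Primes => -(1 / ((p : ℝ) * ((p : ℝ) - 1)))) := by
    refine Summable.neg (Summable.of_nonneg_of_le (fun p => ?_) (fun p => ?_) h2)
    · have hp : (2 : ℝ) ≤ ((p : ℕ) : ℝ) := by exact_mod_cast p.2.two_le
      have : (0 : ℝ) < ((p : ℕ) : ℝ) - 1 := by linarith
      positivity
    · have hp : (2 : ℝ) ≤ ((p : ℕ) : ℝ) := by exact_mod_cast p.2.two_le
      have : (0 : ℝ) < ((p : ℕ) : ℝ) - 1 := by linarith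
      generalize ((p : ℕ) : ℝ) = x at *
      have hx : (0 : ℝ) < x ^ 2 := by positivity
      rw [mul_one_div, div_le_div_iff₀ (by nlinarith) hx]
      nlinarith
  have := (Real.multipliable_one_add_of_summable hs).hasProd
  simpa only [artinConstant, ← sub_eq_add_neg] using this

/-- The main term
`A_k(n) = c n ∏_{p ∣ n} (1 + 1 / (p² - p - 1)) ∏_{q ∣ k} (1 - (q - 1) / (q² - q - 1))`,
with `p` and `q` running over the prime divisors. -/
noncomputable def mainTerm (k n : ℕ) : ℝ :=
  artinConstant * n * (∏ p ∈ n.primeFactors, (1 + 1 / ((p : ℝ) ^ 2 - p - 1))) *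
    ∏ q ∈ k.primeFactors, (1 - ((q : ℝ) - 1) / ((q : ℝ) ^ 2 - q - 1))

/-- `k_n = k / gcd(k, n)`; the division is exact. -/
def coprimePart (k n : ℕ) : ℕ := k / Nat.gcd k n

/-! A prime `p` counts in `R_k(n)` exactly when `n - p` passes a local test at every prime `q`: not
divisible by `q` if `q ∣ k`, not divisible by `q²` otherwise (`gcd_eq_one_and_squarefree_iff`). If
`q ∣ n`, the forbidden class is not a unit and costs nothing in the limit. Otherwise the test passes
with density `1 - 1/(q-1)` or `1 - 1/(q(q-1))`. The product of these densities is the main term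
divided by `n`.

For the tests at `q ≤ y`, with `y` fixed, inclusion–exclusion reduces the count to finitely many
moduli, and the prime number theorem in arithmetic progressions applies uniformly in the class of
`n` (`tendsto_sievedLogSum_sub`). That theorem comes from the continuity of the Dirichlet-series
remainder on `Re s ≥ 1`, through a Tauberian argument with the Fejér kernel.

The tests at `q > y` change the count by at most the sum of `primeLogSum n (q ^ 2)` over `q² ≤ n`.
An elementary bound of order `n log q / q²`, valid up to `q² = n`, makes this a small fraction of
`n` for large `y` (`primeLogSum_sq_le`, `sum_largeModuli_le`). The truncated product is close to the
main term uniformly in `n` (`abs_mainTerm_sub_prod_le`), so the difference of the two normalised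
quantities tends to `0`. A positive lower bound for the main term, independent of `n`, turns this
into asymptotic equivalence and eventual positivity. The factor at `2` vanishes, so for even `k` the
variable must be even, which removes that factor. -/

/-! ### A Tauberian theorem through the Fejér kernel. -/

open MeasureTheory Set Topology in
/-- The Fejér kernel as the Fourier transform of the triangle function. -/
theorem integral_triangle_mul_cexp (t : ℝ) :
    ∫ y in (-1 : ℝ)..1, ((1 - |y| : ℝ) : ℂ) * Complex.exp (Complex.I * t * y) =
      ((Real.sinc (t / 2) ^ 2 : ℝ) : ℂ) := by
  have hcont : Continuous fun y : ℝ =>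
      ((1 - |y| : ℝ) : ℂ) * Complex.exp (Complex.I * t * y) := by fun_prop
  rw [← intervalIntegral.integral_add_adjacent_intervals (b := 0)
    (hcont.intervalIntegrable _ _) (hcont.intervalIntegrable _ _)]
  have e1 : ∫ y in (-1 : ℝ)..0, ((1 - |y| : ℝ) : ℂ) * Complex.exp (Complex.I * t * y) =
      ∫ y in (-1 : ℝ)..0, (1 + (y : ℂ)) * Complex.exp (Complex.I * t * y) := by
    refine intervalIntegral.integral_congr fun y hy => ?_
    rw [uIcc_of_le (by norm_num)] at hy
    simp [abs_of_nonpos hy.2]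
  have e2 : ∫ y in (0 : ℝ)..1, ((1 - |y| : ℝ) : ℂ) * Complex.exp (Complex.I * t * y) =
      ∫ y in (0 : ℝ)..1, (1 - (y : ℂ)) * Complex.exp (Complex.I * t * y) := by
    refine intervalIntegral.integral_congr fun y hy => ?_
    rw [uIcc_of_le (by norm_num)] at hy
    simp [abs_of_nonneg hy.1]
  rw [e1, e2]
  rcases eq_or_ne t 0 with rfl | ht
  · have h1 : ∫ y in (-1 : ℝ)..0, (1 + (y : ℂ)) = 1 / 2 := by
      have : ∀ y : ℝ, (1 + (y : ℂ)) = ((1 + y : ℝ) : ℂ) := by intro y; push_cast; ring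
      simp_rw [this, intervalIntegral.integral_ofReal]
      rw [intervalIntegral.integral_add (by simp) (by simp)]
      simp; norm_num
    have h2 : ∫ y in (0 : ℝ)..1, (1 - (y : ℂ)) = 1 / 2 := by
      have : ∀ y : ℝ, (1 - (y : ℂ)) = ((1 - y : ℝ) : ℂ) := by intro y; push_cast; ring
      simp_rw [this, intervalIntegral.integral_ofReal]
      rw [intervalIntegral.integral_sub (by simp) (by simp)]
      simp; norm_num
    simp [h1, h2]; norm_num
  have htc : (t : ℂ) ≠ 0 := by exact_mod_cast ht
  have hI : Complex.I * t ≠ 0 := mul_ne_zero Complex.I_ne_zero htc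
  set w : ℂ := Complex.I * t with hw
  have hexp : ∀ y : ℝ, HasDerivAt (fun y : ℝ => Complex.exp (w * y)) (Complex.exp (w * y) * w) y := by
    intro y
    have : HasDerivAt (fun y : ℝ => w * (y : ℂ)) w y := by
      simpa using ((hasDerivAt_id y).ofReal_comp).const_mul w
    exact this.cexp
  have hid : ∀ y : ℝ, HasDerivAt (fun y : ℝ => (y : ℂ)) 1 y := fun y => by
    simpa using (hasDerivAt_id y).ofReal_comp
  have i1 : ∫ y in (-1 : ℝ)..0, (1 + (y : ℂ)) * Complex.exp (w * y) =
      1 / w - 1 / w ^ 2 + Complex.exp (-w) / w ^ 2 := by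
    rw [intervalIntegral.integral_eq_sub_of_hasDerivAt
      (f := fun y : ℝ => (1 + (y : ℂ)) * Complex.exp (w * y) / w - Complex.exp (w * y) / w ^ 2)]
    · simp
    · intro y _
      refine HasDerivAt.congr_deriv ((((hid y).const_add 1).mul (hexp y)).div_const w |>.sub
        ((hexp y).div_const (w ^ 2))) ?_
      field_simp; ring
    · exact Continuous.intervalIntegrable (by fun_prop) _ _
  have i2 : ∫ y in (0 : ℝ)..1, (1 - (y : ℂ)) * Complex.exp (w * y) =
      Complex.exp w / w ^ 2 - 1 / w - 1 / w ^ 2 := by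
    rw [intervalIntegral.integral_eq_sub_of_hasDerivAt
      (f := fun y : ℝ => (1 - (y : ℂ)) * Complex.exp (w * y) / w + Complex.exp (w * y) / w ^ 2)]
    · simp; ring
    · intro y _
      refine HasDerivAt.congr_deriv ((((hid y).const_sub 1).mul (hexp y)).div_const w |>.add
        ((hexp y).div_const (w ^ 2))) ?_
      field_simp; ring
    · exact Continuous.intervalIntegrable (by fun_prop) _ _
  rw [i1, i2]
  have hcos : Complex.exp w + Complex.exp (-w) = 2 * Complex.cos t := by
    rw [Complex.cos, hw, mul_comm Complex.I]; ring_nf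
  have hcos2 : Complex.cos t = 1 - 2 * Complex.sin (t / 2) ^ 2 := by
    have := Complex.cos_two_mul' ((t : ℂ) / 2)
    have h2 := Complex.sin_sq_add_cos_sq ((t : ℂ) / 2)
    rw [mul_div_cancel₀ _ two_ne_zero] at this
    linear_combination this + h2
  have hw2 : w ^ 2 = -(t : ℂ) ^ 2 := by rw [hw, mul_pow, Complex.I_sq]; ring
  rw [Real.sinc_of_ne_zero (by simpa using ht)]
  push_cast
  have : 1 / w - 1 / w ^ 2 + Complex.exp (-w) / w ^ 2 + (Complex.exp w / w ^ 2 - 1 / w - 1 / w ^ 2)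
      = (Complex.exp w + Complex.exp (-w) - 2) / w ^ 2 := by ring
  rw [this, hcos, hcos2, hw2]
  field_simp; ring

theorem sinc_sq_le (t : ℝ) : Real.sinc (t / 2) ^ 2 ≤ 5 * (1 + t ^ 2)⁻¹ := by
  rw [← div_eq_mul_inv, le_div_iff₀ (by positivity)]
  have h1 : Real.sinc (t / 2) ^ 2 ≤ 1 := by
    rw [sq_le_one_iff_abs_le_one]
    exact abs_le.2 ⟨Real.neg_one_le_sinc _, Real.sinc_le_one _⟩
  have h2 : Real.sinc (t / 2) ^ 2 * t ^ 2 ≤ 4 := by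
    rcases eq_or_ne t 0 with rfl | ht
    · norm_num
    rw [Real.sinc_of_ne_zero (by simpa using ht)]
    have := Real.sin_sq_le_one (t / 2)
    have e : (Real.sin (t / 2) / (t / 2)) ^ 2 * t ^ 2 = 4 * Real.sin (t / 2) ^ 2 := by
      field_simp; ring
    linarith
  linarith

theorem continuous_sinc_sq : Continuous fun t : ℝ => Real.sinc (t / 2) ^ 2 := by
  have := Real.continuous_sinc
  fun_prop

open MeasureTheory in
theorem integrable_sinc_sq : Integrable fun t : ℝ => Real.sinc (t / 2) ^ 2 := by
  refine (integrable_inv_one_add_sq.const_mul 5).mono' continuous_sinc_sq.aestronglyMeasurable ?_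
  refine .of_forall fun t => ?_
  rw [Real.norm_of_nonneg (by positivity)]
  exact sinc_sq_le t

open MeasureTheory in
theorem integral_sinc_sq_pos : 0 < ∫ t : ℝ, Real.sinc (t / 2) ^ 2 := by
  refine integral_pos_of_integrable_nonneg_nonzero (x := 0) continuous_sinc_sq integrable_sinc_sq
    (fun t => sq_nonneg _) (by simp)

-- The damping `exp (-σ t)` makes the double integral absolutely convergent, so once the kernel is
-- written as the Fourier transform of the triangle, Fubini leaves the Laplace transform on the line
-- `Re s = σ`.
open MeasureTheory Set Topology in
theorem integral_damped_mul_sinc_sq {f : ℝ → ℝ} (hm : Measurable f) {C : ℝ} (hb : ∀ t, |f t| ≤ C)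
    {F : ℂ → ℂ} (hF : ∀ s : ℂ, 0 < s.re → ∫ t in Ioi (0 : ℝ), (f t : ℂ) * Complex.exp (-s * t) = F s)
    (l T : ℝ) {σ : ℝ} (hσ : 0 < σ) :
    ∫ t in Ioi (0 : ℝ), ((f t * Real.exp (-σ * t) * Real.sinc (l * (t - T) / 2) ^ 2 : ℝ) : ℂ) =
      ∫ y in (-1 : ℝ)..1, ((1 - |y| : ℝ) : ℂ) * Complex.exp (-(Complex.I * (l * T * y))) *
        F (σ - Complex.I * (l * y)) := by
  have hC : 0 ≤ C := (abs_nonneg _).trans (hb 0)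
  set g : ℝ → ℝ → ℂ := fun t y => ((f t * Real.exp (-σ * t) : ℝ) : ℂ) *
    (((1 - |y| : ℝ) : ℂ) * Complex.exp (Complex.I * (l * (t - T) : ℝ) * y)) with hg
  have hL : ∫ t in Ioi (0 : ℝ),
      ((f t * Real.exp (-σ * t) * Real.sinc (l * (t - T) / 2) ^ 2 : ℝ) : ℂ) =
      ∫ t in Ioi (0 : ℝ), ∫ y in Ioc (-1 : ℝ) 1, g t y := by
    refine integral_congr_ae (.of_forall fun t => ?_)
    simp only [hg]
    rw [integral_const_mul, ← intervalIntegral.integral_of_le (by norm_num),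
      integral_triangle_mul_cexp]
    push_cast; ring
  have hR : ∀ y : ℝ, ∫ t in Ioi (0 : ℝ), g t y =
      ((1 - |y| : ℝ) : ℂ) * Complex.exp (-(Complex.I * (l * T * y))) *
        F (σ - Complex.I * (l * y)) := by
    intro y
    rw [← hF _ (by simpa using hσ), ← integral_const_mul]
    refine integral_congr_ae (.of_forall fun t => ?_)
    simp only [hg]
    have : Complex.exp (-(σ - Complex.I * (l * y)) * t) * Complex.exp (-(Complex.I * (l * T * y))) =
        Complex.exp ((-σ * t : ℝ)) * Complex.exp (Complex.I * (l * (t - T) : ℝ) * y) := by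
      rw [← Complex.exp_add, ← Complex.exp_add]; congr 1; push_cast; ring
    rw [Complex.ofReal_mul, Complex.ofReal_exp]
    linear_combination (-((1 - |y| : ℝ) : ℂ) * (f t : ℂ)) * this
  rw [hL, integral_integral_swap, intervalIntegral.integral_of_le (by norm_num)]
  · simp_rw [hR]
  have hint : Integrable (fun t : ℝ => C * Real.exp (-σ * t)) (volume.restrict (Ioi 0)) :=
    (integrableOn_exp_mul_Ioi (by linarith : -σ < 0) 0).const_mul C
  have hone : Integrable (fun _ : ℝ => (1 : ℝ)) (volume.restrict (Ioc (-1) 1)) := by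
    simp
  have hmeas : Measurable (Function.uncurry g) := by
    simp only [hg, Function.uncurry_def]
    fun_prop
  refine (hint.mul_prod hone).mono' hmeas.aestronglyMeasurable ?_
  rw [Measure.prod_restrict]
  refine (ae_restrict_mem (measurableSet_Ioi.prod measurableSet_Ioc)).mono ?_
  rintro ⟨t, y⟩ ⟨ht, hy⟩
  simp only [mem_Ioi, mem_Ioc] at ht hy
  simp only [hg, Function.uncurry_def, norm_mul, Complex.norm_real]
  have h1 : ‖Complex.exp (Complex.I * (l * (t - T) : ℝ) * y)‖ = 1 := by
    rw [show Complex.I * (l * (t - T) : ℝ) * y = ((l * (t - T) * y : ℝ) : ℂ) * Complex.I by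
      push_cast; ring]
    exact Complex.norm_exp_ofReal_mul_I _
  have h2 : ‖1 - |y|‖ ≤ 1 := by
    have := abs_le.2 ⟨hy.1.le, hy.2⟩
    have := abs_nonneg y
    rw [Real.norm_of_nonneg (by linarith)]; linarith
  rw [h1, mul_one, Real.norm_of_nonneg (Real.exp_pos _).le]
  exact mul_le_mul (mul_le_mul_of_nonneg_right (hb t) (Real.exp_pos _).le) h2 (norm_nonneg _)
    (by positivity)

-- Let `σ → 0⁺` in the damped identity. The left side is dominated by `C` times the kernel; on the
-- right, `F` is bounded on a compact piece of the closed half-plane.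
open MeasureTheory Set Topology in
theorem integral_mul_sinc_sq {f : ℝ → ℝ} (hm : Measurable f) {C : ℝ} (hb : ∀ t, |f t| ≤ C)
    {F : ℂ → ℂ} (hF : ∀ s : ℂ, 0 < s.re → ∫ t in Ioi (0 : ℝ), (f t : ℂ) * Complex.exp (-s * t) = F s)
    (hcont : ContinuousOn F {s | 0 ≤ s.re}) {l : ℝ} (hl : 0 < l) (T : ℝ) :
    ∫ t in Ioi (0 : ℝ), ((f t * Real.sinc (l * (t - T) / 2) ^ 2 : ℝ) : ℂ) =
      ∫ y in (-1 : ℝ)..1, ((1 - |y| : ℝ) : ℂ) * Complex.exp (-(Complex.I * (l * T * y))) *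
        F (-(Complex.I * (l * y))) := by
  have hK : Integrable (fun t : ℝ => Real.sinc (l * (t - T) / 2) ^ 2) :=
    (integrable_sinc_sq.comp_mul_left' hl.ne').comp_sub_right T
  have hKm : Measurable (fun t : ℝ => Real.sinc (l * (t - T) / 2) ^ 2) := by
    have := Real.continuous_sinc
    exact Continuous.measurable (by fun_prop)
  have hleft : Tendsto (fun σ : ℝ => ∫ t in Ioi (0 : ℝ),
      ((f t * Real.exp (-σ * t) * Real.sinc (l * (t - T) / 2) ^ 2 : ℝ) : ℂ)) (𝓝[>] 0)
      (𝓝 (∫ t in Ioi (0 : ℝ), ((f t * Real.sinc (l * (t - T) / 2) ^ 2 : ℝ) : ℂ))) := by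
    refine tendsto_integral_filter_of_dominated_convergence
      (fun t => C * Real.sinc (l * (t - T) / 2) ^ 2) ?_ ?_ (hK.const_mul C).integrableOn ?_
    · exact .of_forall fun σ => Measurable.aestronglyMeasurable (by fun_prop)
    · filter_upwards [self_mem_nhdsWithin] with σ hσ
      refine (ae_restrict_mem measurableSet_Ioi).mono fun t ht => ?_
      simp only [mem_Ioi] at hσ ht
      rw [Complex.norm_real, norm_mul, norm_mul, Real.norm_of_nonneg (sq_nonneg (Real.sinc _)),
        Real.norm_of_nonneg (Real.exp_pos _).le]
      refine mul_le_mul_of_nonneg_right ?_ (sq_nonneg _)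
      have : Real.exp (-σ * t) ≤ 1 := Real.exp_le_one_iff.2 (by nlinarith)
      calc |f t| * Real.exp (-σ * t) ≤ |f t| * 1 := mul_le_mul_of_nonneg_left this (abs_nonneg _)
        _ ≤ C := by simpa using hb t
    · refine .of_forall fun t => ?_
      have : Continuous fun σ : ℝ =>
        ((f t * Real.exp (-σ * t) * Real.sinc (l * (t - T) / 2) ^ 2 : ℝ) : ℂ) := by fun_prop
      simpa using (this.tendsto 0).mono_left nhdsWithin_le_nhds
  have hright : Tendsto (fun σ : ℝ => ∫ y in (-1 : ℝ)..1, ((1 - |y| : ℝ) : ℂ) *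
      Complex.exp (-(Complex.I * (l * T * y))) * F (σ - Complex.I * (l * y))) (𝓝[>] 0)
      (𝓝 (∫ y in (-1 : ℝ)..1, ((1 - |y| : ℝ) : ℂ) * Complex.exp (-(Complex.I * (l * T * y))) *
        F (-(Complex.I * (l * y))))) := by
    set k : ℝ × ℝ → ℂ := fun p => ((1 - |p.2| : ℝ) : ℂ) *
      Complex.exp (-(Complex.I * (l * T * p.2))) * F (p.1 - Complex.I * (l * p.2)) with hk
    have hkc : ContinuousOn k (Icc 0 1 ×ˢ Icc (-1) 1) := by
      refine ContinuousOn.mul (by fun_prop) (hcont.comp (by fun_prop) ?_)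
      rintro ⟨σ, y⟩ ⟨hσ, -⟩
      simpa using hσ.1
    obtain ⟨M, hM⟩ := (isCompact_Icc.prod isCompact_Icc).exists_bound_of_continuousOn hkc
    have h01 : ∀ᶠ σ : ℝ in 𝓝[>] 0, σ ∈ Icc (0 : ℝ) 1 := by
      filter_upwards [Ioc_mem_nhdsGT (zero_lt_one (α := ℝ))] with σ hσ using ⟨hσ.1.le, hσ.2⟩
    have hsub : Ioc (-1 : ℝ) 1 ⊆ Icc (-1) 1 := Ioc_subset_Icc_self
    refine intervalIntegral.tendsto_integral_filter_of_dominated_convergence (fun _ => M) ?_ ?_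
      (by simp) ?_
    · filter_upwards [h01] with σ hσ
      rw [uIoc_of_le (by norm_num)]
      refine ContinuousOn.aestronglyMeasurable ?_ measurableSet_Ioc
      exact hkc.comp (f := fun y : ℝ => (σ, y)) (by fun_prop) fun y hy => ⟨hσ, hsub hy⟩
    · filter_upwards [h01] with σ hσ
      refine .of_forall fun y hy => ?_
      rw [uIoc_of_le (by norm_num)] at hy
      exact hM (σ, y) ⟨hσ, hsub hy⟩
    · refine .of_forall fun y hy => ?_
      rw [uIoc_of_le (by norm_num)] at hy
      have h1 : Tendsto (fun σ : ℝ => (σ, y)) (𝓝[>] 0) (𝓝[Icc 0 1 ×ˢ Icc (-1) 1] (0, y)) := by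
        refine tendsto_nhdsWithin_iff.2 ⟨?_, ?_⟩
        · exact (Continuous.tendsto (by fun_prop) (0 : ℝ)).mono_left nhdsWithin_le_nhds
        · filter_upwards [h01] with σ hσ using ⟨hσ, hsub hy⟩
      have := (hkc (0, y) ⟨by simp, hsub hy⟩).tendsto.comp h1
      simpa [hk, Function.comp_def] using this
  refine tendsto_nhds_unique (hleft.congr' ?_) hright
  filter_upwards [self_mem_nhdsWithin] with σ hσ
  exact integral_damped_mul_sinc_sq hm hb hF l T hσ

-- On the Fourier side `T` occurs only in the phase, so this is the Riemann–Lebesgue lemma.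
open MeasureTheory Set Topology in
theorem tendsto_integral_mul_sinc_sq {f : ℝ → ℝ} (hm : Measurable f) {C : ℝ}
    (hb : ∀ t, |f t| ≤ C) {F : ℂ → ℂ}
    (hF : ∀ s : ℂ, 0 < s.re → ∫ t in Ioi (0 : ℝ), (f t : ℂ) * Complex.exp (-s * t) = F s)
    (hcont : ContinuousOn F {s | 0 ≤ s.re}) {l : ℝ} (hl : 0 < l) :
    Tendsto (fun T : ℝ => ∫ t in Ioi (0 : ℝ), f t * Real.sinc (l * (t - T) / 2) ^ 2)
      atTop (𝓝 0) := by
  have h1 := Real.tendsto_integral_exp_smul_cocompact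
    ((Ioc (-1 : ℝ) 1).indicator fun y : ℝ => ((1 - |y| : ℝ) : ℂ) * F (-(Complex.I * (l * y))))
  have h2 : Tendsto (fun T : ℝ => l * T / (2 * Real.pi)) atTop (cocompact ℝ) := by
    refine Tendsto.mono_right ?_ atTop_le_cocompact
    exact (tendsto_id.const_mul_atTop hl).atTop_div_const (by positivity)
  have h3 := h1.comp h2
  have h4 : Tendsto (fun T : ℝ => ((∫ t in Ioi (0 : ℝ), f t * Real.sinc (l * (t - T) / 2) ^ 2 : ℝ) : ℂ))
      atTop (𝓝 ((0 : ℝ) : ℂ)) := by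
    rw [Complex.ofReal_zero]
    refine h3.congr fun T => ?_
    refine Eq.trans ?_ ((integral_mul_sinc_sq hm hb hF hcont hl T).symm.trans
      (integral_ofReal (𝕜 := ℂ)))
    rw [intervalIntegral.integral_of_le (by norm_num), ← integral_indicator measurableSet_Ioc]
    refine integral_congr_ae (.of_forall fun y => ?_)
    simp only [indicator]
    split_ifs
    · rw [Circle.smul_def, Real.fourierChar_apply, smul_eq_mul]
      have : ((2 * Real.pi * (-(y * (l * T / (2 * Real.pi)))) : ℝ) : ℂ) * Complex.I =
          -(Complex.I * (l * T * y)) := by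
        have : (Real.pi : ℂ) ≠ 0 := by exact_mod_cast Real.pi_ne_zero
        push_cast; field_simp
      rw [this]; ring
    · simp
  simpa only [Function.comp_def, Complex.ofReal_re] using (Complex.continuous_re.tendsto _).comp h4

-- Substitute `x = l (t - T)`. The Laplace transform sees only `t > 0`; the rest of the line drops
-- out by dominated convergence, because `T + x / l` is eventually positive for each `x`.
open MeasureTheory Set Topology in
theorem tendsto_integral_translate_mul_sinc_sq {f : ℝ → ℝ} (hm : Measurable f) {C : ℝ}
    (hb : ∀ t, |f t| ≤ C) {F : ℂ → ℂ}
    (hF : ∀ s : ℂ, 0 < s.re → ∫ t in Ioi (0 : ℝ), (f t : ℂ) * Complex.exp (-s * t) = F s)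
    (hcont : ContinuousOn F {s | 0 ≤ s.re}) {l : ℝ} (hl : 0 < l) :
    Tendsto (fun T : ℝ => ∫ x : ℝ, f (T + x / l) * Real.sinc (x / 2) ^ 2) atTop (𝓝 0) := by
  have h1 : ∀ T, ∫ t in Ioi (0 : ℝ), f t * Real.sinc (l * (t - T) / 2) ^ 2 =
      l⁻¹ * ∫ x : ℝ, (Ioi (0 : ℝ)).indicator f (T + x / l) * Real.sinc (x / 2) ^ 2 := by
    intro T
    rw [← integral_indicator measurableSet_Ioi]
    have h := Measure.integral_comp_mul_left
      (fun x => (Ioi (0 : ℝ)).indicator f (T + x / l) * Real.sinc (x / 2) ^ 2) l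
    rw [abs_of_pos (inv_pos.2 hl), smul_eq_mul] at h
    rw [← h, ← integral_sub_right_eq_self (fun x =>
      (Ioi (0 : ℝ)).indicator f (T + l * x / l) * Real.sinc (l * x / 2) ^ 2) T]
    refine integral_congr_ae (.of_forall fun t => ?_)
    have : T + l * (t - T) / l = t := by field_simp; ring
    simp only [this]
    by_cases ht : t ∈ Ioi (0 : ℝ)
    · rw [indicator_of_mem ht, indicator_of_mem ht]
    · rw [indicator_of_notMem ht, indicator_of_notMem ht, zero_mul]
  have h2 : Tendsto (fun T : ℝ => ∫ x : ℝ, (Ioi (0 : ℝ)).indicator f (T + x / l) *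
      Real.sinc (x / 2) ^ 2) atTop (𝓝 0) := by
    have := (tendsto_integral_mul_sinc_sq hm hb hF hcont hl).const_mul l
    rw [mul_zero] at this
    refine this.congr fun T => ?_
    rw [h1]; field_simp
  have hsm : Measurable fun x : ℝ => Real.sinc (x / 2) ^ 2 := continuous_sinc_sq.measurable
  have hdom : ∀ (g : ℝ → ℝ), Measurable g → (∀ t, |g t| ≤ C) → ∀ T : ℝ,
      Integrable fun x : ℝ => g (T + x / l) * Real.sinc (x / 2) ^ 2 := by
    intro g hg hgb T
    refine (integrable_sinc_sq.const_mul C).mono' (Measurable.aestronglyMeasurable (by fun_prop))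
      (.of_forall fun x => ?_)
    rw [norm_mul, Real.norm_of_nonneg (sq_nonneg (Real.sinc _))]
    exact mul_le_mul_of_nonneg_right (hgb _) (sq_nonneg _)
  have hC : 0 ≤ C := (abs_nonneg _).trans (hb 0)
  have hIic : ∀ t, |(Iic (0 : ℝ)).indicator f t| ≤ C := fun t => by
    simp only [indicator]; split_ifs; exacts [hb t, by simpa]
  have hIoi : ∀ t, |(Ioi (0 : ℝ)).indicator f t| ≤ C := fun t => by
    simp only [indicator]; split_ifs; exacts [hb t, by simpa]
  have h3 : Tendsto (fun T : ℝ => ∫ x : ℝ, (Iic (0 : ℝ)).indicator f (T + x / l) *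
      Real.sinc (x / 2) ^ 2) atTop (𝓝 (∫ _ : ℝ, (0 : ℝ))) := by
    refine tendsto_integral_filter_of_dominated_convergence
      (fun x => C * Real.sinc (x / 2) ^ 2) ?_ ?_ (integrable_sinc_sq.const_mul C) ?_
    · exact .of_forall fun T => (hdom _ (hm.indicator measurableSet_Iic) hIic T).1
    · refine .of_forall fun T => .of_forall fun x => ?_
      rw [norm_mul, Real.norm_of_nonneg (sq_nonneg (Real.sinc _))]
      exact mul_le_mul_of_nonneg_right (hIic _) (sq_nonneg _)
    · refine .of_forall fun x => tendsto_const_nhds.congr' ?_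
      filter_upwards [eventually_gt_atTop (-(x / l))] with T hT
      rw [indicator_of_notMem (by simp; linarith), zero_mul]
  rw [integral_zero] at h3
  have h4 := h2.add h3
  rw [add_zero] at h4
  refine h4.congr fun T => ?_
  rw [← integral_add (hdom _ (hm.indicator measurableSet_Ioi) hIoi T)
    (hdom _ (hm.indicator measurableSet_Iic) hIic T)]
  refine integral_congr_ae (.of_forall fun x => ?_)
  simp only [indicator, mem_Ioi, mem_Iic]
  by_cases h : 0 < T + x / l
  · simp [h, not_le.2 h]
  · simp [h, not_lt.1 h]

open MeasureTheory Set Topology in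
/-- A Tauberian theorem of Wiener–Ikehara type, for bounded functions. -/
theorem tendsto_of_laplace_continuousOn {u : ℝ → ℝ} (hm : Measurable u) {C A : ℝ}
    (h0 : ∀ t, 0 ≤ u t) (hb : ∀ t, u t ≤ C) (hA : 0 ≤ A)
    (hmono : ∀ s t, s ≤ t → u s ≤ Real.exp (t - s) * u t) {F : ℂ → ℂ}
    (hF : ∀ s : ℂ, 0 < s.re →
      ∫ t in Ioi (0 : ℝ), ((u t - A : ℝ) : ℂ) * Complex.exp (-s * t) = F s)
    (hcont : ContinuousOn F {s | 0 ≤ s.re}) : Tendsto u atTop (𝓝 A) := by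
  have hC : 0 ≤ C := (h0 0).trans (hb 0)
  set K : ℝ → ℝ := fun x => Real.sinc (x / 2) ^ 2 with hK
  have hK0 : ∀ x, 0 ≤ K x := fun x => sq_nonneg _
  have hKi : Integrable K := integrable_sinc_sq
  set κ := ∫ x, K x with hκ
  have hκ0 : 0 < κ := integral_sinc_sq_pos
  have hab : ∀ t, |u t - A| ≤ C + A := fun t => by
    rw [abs_le]; constructor <;> linarith [h0 t, hb t]
  have hint : ∀ T l : ℝ, Integrable fun x => u (T + x / l) * K x := by
    intro T l
    refine (hKi.const_mul C).mono' (Measurable.aestronglyMeasurable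
      (by have := continuous_sinc_sq.measurable; fun_prop)) (.of_forall fun x => ?_)
    rw [norm_mul, Real.norm_of_nonneg (hK0 x), Real.norm_of_nonneg (h0 _)]
    exact mul_le_mul_of_nonneg_right (hb _) (hK0 x)
  have hlim : ∀ l : ℝ, 0 < l → Tendsto (fun T : ℝ => ∫ x, u (T + x / l) * K x) atTop
      (𝓝 (A * κ)) := by
    intro l hl
    have := (tendsto_integral_translate_mul_sinc_sq (hm.sub_const A) hab hF hcont hl).add_const
      (A * κ)
    rw [zero_add] at this
    refine this.congr fun T => ?_
    have e : (fun x => (u (T + x / l) - A) * Real.sinc (x / 2) ^ 2) =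
        fun x => u (T + x / l) * K x - A * K x := by
      ext x; simp only [hK]; ring
    rw [e, integral_sub (hint T l) (hKi.const_mul A), integral_const_mul]
    ring
  have hmass : Tendsto (fun b : ℝ => ∫ x in Ioc (-b) b, K x) atTop (𝓝 κ) := by
    have := intervalIntegral_tendsto_integral hKi tendsto_neg_atTop_atBot tendsto_id
    refine this.congr' ?_
    filter_upwards [eventually_ge_atTop 0] with b hb0
    exact intervalIntegral.integral_of_le (by simp only [id]; linarith)
  have hmassle : ∀ b : ℝ, ∫ x in Ioc (-b) b, K x ≤ κ := fun b =>
    setIntegral_le_integral hKi (.of_forall hK0)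
  -- With `l = b / δ` the window `|x| ≤ b` corresponds to shifts `|x / l| ≤ δ`, on which `hmono`
  -- compares `u` with its value at an endpoint at the cost of `exp (2δ)`.
  have hup : ∀ δ b T : ℝ, 0 < δ → 0 < b →
      u (T - δ) * (∫ x in Ioc (-b) b, K x) ≤ Real.exp (2 * δ) * ∫ x, u (T + x / (b / δ)) * K x := by
    intro δ b T hδ hb0
    rw [← integral_const_mul, ← integral_const_mul]
    refine (setIntegral_mono_on (hKi.const_mul _).integrableOn
      ((hint T _).const_mul _).integrableOn measurableSet_Ioc fun x hx => ?_).trans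
      (setIntegral_le_integral ((hint T _).const_mul _) (.of_forall fun x => ?_))
    · rw [← mul_assoc]
      refine mul_le_mul_of_nonneg_right ?_ (hK0 x)
      have h1 : -δ ≤ x / (b / δ) := by
        rw [le_div_iff₀ (by positivity)]; field_simp; linarith [hx.1]
      have h2 : x / (b / δ) ≤ δ := by
        rw [div_le_iff₀ (by positivity)]; field_simp; linarith [hx.2]
      refine (hmono (T - δ) (T + x / (b / δ)) (by linarith)).trans ?_
      exact mul_le_mul_of_nonneg_right (Real.exp_le_exp.2 (by linarith)) (h0 _)
    · exact mul_nonneg (Real.exp_pos _).le (mul_nonneg (h0 _) (hK0 x))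
  have hlow : ∀ δ b T : ℝ, 0 < δ → 0 < b → ∫ x, u (T + x / (b / δ)) * K x ≤
      Real.exp (2 * δ) * u (T + δ) * κ + C * (κ - ∫ x in Ioc (-b) b, K x) := by
    intro δ b T hδ hb0
    have hsplit := integral_add_compl (measurableSet_Ioc (a := -b) (b := b)) (hint T (b / δ))
    have hsplitK := integral_add_compl (measurableSet_Ioc (a := -b) (b := b)) hKi
    have h1 : ∫ x in Ioc (-b) b, u (T + x / (b / δ)) * K x ≤
        Real.exp (2 * δ) * u (T + δ) * κ := by
      refine (setIntegral_mono_on (hint T _).integrableOn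
        (hKi.const_mul (Real.exp (2 * δ) * u (T + δ))).integrableOn measurableSet_Ioc
        fun x hx => ?_).trans ?_
      · refine mul_le_mul_of_nonneg_right ?_ (hK0 x)
        have h1 : -δ ≤ x / (b / δ) := by
          rw [le_div_iff₀ (by positivity)]; field_simp; linarith [hx.1]
        have h2 : x / (b / δ) ≤ δ := by
          rw [div_le_iff₀ (by positivity)]; field_simp; linarith [hx.2]
        refine (hmono (T + x / (b / δ)) (T + δ) (by linarith)).trans ?_
        exact mul_le_mul_of_nonneg_right (Real.exp_le_exp.2 (by linarith)) (h0 _)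
      · rw [integral_const_mul]
        exact mul_le_mul_of_nonneg_left (hmassle b) (mul_nonneg (Real.exp_pos _).le (h0 _))
    have h2 : ∫ x in (Ioc (-b) b)ᶜ, u (T + x / (b / δ)) * K x ≤
        C * (κ - ∫ x in Ioc (-b) b, K x) := by
      rw [hκ, ← hsplitK, add_sub_cancel_left, ← integral_const_mul]
      exact setIntegral_mono_on (hint T _).integrableOn (hKi.const_mul C).integrableOn
        measurableSet_Ioc.compl fun x _ => mul_le_mul_of_nonneg_right (hb _) (hK0 x)
    linarith
  have hexp1 : ∀ c : ℝ, Tendsto (fun δ : ℝ => Real.exp (c * δ)) (𝓝[>] 0) (𝓝 1) := fun c => by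
    have : Continuous fun δ : ℝ => Real.exp (c * δ) := by fun_prop
    simpa using (this.tendsto 0).mono_left nhdsWithin_le_nhds
  -- In both halves `δ` is fixed first, to absorb `exp (2δ)`, then `b`, so that the window carries
  -- nearly all the mass of the kernel, and `T → ∞` last.
  refine tendsto_order.2 ⟨fun a ha => ?_, fun a ha => ?_⟩
  · obtain ⟨δ, hδa, hδ⟩ : ∃ δ : ℝ, Real.exp (2 * δ) * a < A ∧ 0 < δ := by
      have h := ((hexp1 2).mul_const a).eventually_lt_const (by simpa using ha)
      obtain ⟨δ, h1, h2⟩ := (h.and self_mem_nhdsWithin).exists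
      exact ⟨δ, h1, h2⟩
    obtain ⟨b, hb1, hb0⟩ : ∃ b : ℝ, Real.exp (2 * δ) * a * κ + C * (κ - ∫ x in Ioc (-b) b, K x) <
        A * κ ∧ 0 < b := by
      have h : Tendsto (fun b : ℝ => Real.exp (2 * δ) * a * κ +
          C * (κ - ∫ x in Ioc (-b) b, K x)) atTop (𝓝 (Real.exp (2 * δ) * a * κ + C * (κ - κ))) :=
        ((hmass.const_sub κ).const_mul C).const_add _
      have := h.eventually_lt_const (u := A * κ) (by
        rw [sub_self, mul_zero, add_zero]; exact mul_lt_mul_of_pos_right hδa hκ0)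
      exact (this.and (eventually_gt_atTop 0)).exists
    have h1 := (hlim (b / δ) (by positivity)).eventually_const_lt hb1
    have h2 := (tendsto_atTop_add_const_right _ (-δ) tendsto_id).eventually h1
    filter_upwards [h2] with T hT
    have h3 := hlow δ b (T + -δ) hδ hb0
    simp only [id] at hT
    rw [neg_add_cancel_right] at h3
    have h4 : Real.exp (2 * δ) * a * κ < Real.exp (2 * δ) * u T * κ := by linarith
    exact lt_of_mul_lt_mul_left (lt_of_mul_lt_mul_right h4 hκ0.le) (Real.exp_pos _).le
  · have ha0 : 0 < a := hA.trans_lt ha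
    obtain ⟨δ, hδa, hδ⟩ : ∃ δ : ℝ, Real.exp (2 * δ) * A < a ∧ 0 < δ := by
      have h := ((hexp1 2).mul_const A).eventually_lt_const (by simpa using ha)
      obtain ⟨δ, h1, h2⟩ := (h.and self_mem_nhdsWithin).exists
      exact ⟨δ, h1, h2⟩
    obtain ⟨b, hb1, hb0⟩ : ∃ b : ℝ, Real.exp (2 * δ) * (A * κ) < a * ∫ x in Ioc (-b) b, K x ∧
        0 < b := by
      have := (hmass.const_mul a).eventually_const_lt (u := Real.exp (2 * δ) * (A * κ)) (by
        rw [← mul_assoc]; exact mul_lt_mul_of_pos_right hδa hκ0)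
      obtain ⟨b, h1, h2⟩ := (this.and (eventually_gt_atTop 0)).exists
      exact ⟨b, h1, h2⟩
    have h1 := ((hlim (b / δ) (by positivity)).const_mul (Real.exp (2 * δ))).eventually_lt_const hb1
    have h2 := (tendsto_atTop_add_const_right _ δ tendsto_id).eventually h1
    filter_upwards [h2] with T hT
    have h3 := hup δ b (T + δ) hδ hb0
    simp only [id] at hT
    rw [add_sub_cancel_right] at h3
    exact lt_of_mul_lt_mul_right (h3.trans_lt hT) (integral_nonneg hK0)

/-! ### The prime number theorem in arithmetic progressions. -/

open ArithmeticFunction.vonMangoldt in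
theorem sum_residueClass_le {q : ℕ} (a : ZMod q) {x : ℝ} (hx : 0 ≤ x) :
    ∑ k ∈ Finset.Icc 1 ⌊x⌋₊, residueClass a k ≤ (Real.log 4 + 4) * x := by
  refine le_trans ?_ (Chebyshev.psi_le_const_mul_self hx)
  rw [Chebyshev.psi]
  exact Finset.sum_le_sum fun k _ => residueClass_le a k

-- Partial summation followed by `x = exp t`; Chebyshev's bound supplies the required growth
-- condition.
open ArithmeticFunction.vonMangoldt MeasureTheory Set Topology in
theorem LSeries_residueClass_eq_laplace {q : ℕ} (a : ZMod q) {s : ℂ} (hs : 0 < s.re) :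
    LSeries (fun n => (residueClass a n : ℂ)) (s + 1) =
      (s + 1) * ∫ t in Ioi (0 : ℝ),
        (((∑ k ∈ Finset.Icc 1 ⌊Real.exp t⌋₊, residueClass a k) / Real.exp t : ℝ) : ℂ) *
          Complex.exp (-s * t) := by
  rw [LSeries_eq_mul_integral_of_nonneg _ zero_le_one (by simpa using hs) ?_
    (residueClass_nonneg a)]
  · congr 1
    have himg : Real.exp '' Ioi 0 = Ioi 1 := by
      ext x
      simp only [mem_image, mem_Ioi]
      constructor
      · rintro ⟨t, ht, rfl⟩; exact Real.one_lt_exp_iff.2 ht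
      · intro hx
        exact ⟨Real.log x, Real.log_pos hx, Real.exp_log (by linarith)⟩
    rw [← himg, integral_image_eq_integral_abs_deriv_smul measurableSet_Ioi
      (fun x _ => (Real.hasDerivAt_exp x).hasDerivWithinAt) Real.exp_injective.injOn]
    refine integral_congr_ae (.of_forall fun t => ?_)
    have hne : ((Real.exp t : ℝ) : ℂ) ≠ 0 := by exact_mod_cast (Real.exp_pos t).ne'
    simp only []
    rw [Complex.cpow_def_of_ne_zero hne, ← Complex.ofReal_log (Real.exp_pos t).le, Real.log_exp,
      abs_of_pos (Real.exp_pos t), Complex.real_smul]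
    have h1 : Complex.exp (t * -(s + 1 + 1)) =
        Complex.exp (-s * t) / (Complex.exp t * Complex.exp t) := by
      rw [← Complex.exp_add, ← Complex.exp_sub]; congr 1; ring
    rw [h1]
    push_cast
    have := Complex.exp_ne_zero t
    field_simp
  · refine IsBigO.of_bound (Real.log 4 + 4) (.of_forall fun n => ?_)
    rw [Real.norm_of_nonneg (Finset.sum_nonneg fun k _ => residueClass_nonneg a k)]
    simpa using sum_residueClass_le a (Nat.cast_nonneg n)

open ArithmeticFunction.vonMangoldt MeasureTheory Set Topology in
/-- The prime number theorem in arithmetic progressions, for the von Mangoldt function. -/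
theorem tendsto_sum_residueClass_div {q : ℕ} [NeZero q] {a : ZMod q} (ha : IsUnit a) :
    Tendsto (fun n : ℕ => (∑ k ∈ Finset.Icc 1 n, residueClass a k) / (n : ℝ)) atTop
      (𝓝 ((q.totient : ℝ)⁻¹)) := by
  set A : ℝ := (q.totient : ℝ)⁻¹ with hA
  have hA0 : 0 ≤ A := by positivity
  set Ψ : ℝ → ℝ := fun x => ∑ k ∈ Finset.Icc 1 ⌊x⌋₊, residueClass a k with hΨ
  have hΨmono : Monotone Ψ := fun x y hxy =>
    Finset.sum_le_sum_of_subset_of_nonneg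
      (Finset.Icc_subset_Icc_right (Nat.floor_mono hxy)) fun k _ _ => residueClass_nonneg a k
  have hΨ0 : ∀ x, 0 ≤ Ψ x := fun x => Finset.sum_nonneg fun k _ => residueClass_nonneg a k
  set u : ℝ → ℝ := fun t => Ψ (Real.exp t) / Real.exp t with hu
  have hum : Measurable u := (hΨmono.measurable.comp Real.measurable_exp).div Real.measurable_exp
  have hu0 : ∀ t, 0 ≤ u t := fun t => div_nonneg (hΨ0 _) (Real.exp_pos t).le
  have hub : ∀ t, u t ≤ Real.log 4 + 4 := fun t => by
    rw [hu, div_le_iff₀ (Real.exp_pos t)]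
    exact sum_residueClass_le a (Real.exp_pos t).le
  have key : Tendsto u atTop (𝓝 A) := by
    -- With `G` the Dirichlet series minus its polar part `A / s` at `s + 1`, the transform of `u -
    -- A` is `(G + A/s)/(s+1) - A/s = (G - A)/(s+1)`: the pole cancels. Monotonicity of `Ψ` gives
    -- the Tauberian condition.
    refine tendsto_of_laplace_continuousOn (C := Real.log 4 + 4)
      (F := fun s => (LFunctionResidueClassAux a (s + 1) - A) / (s + 1)) hum hu0 hub hA0 ?_ ?_ ?_
    · intro s t hst
      have h : Real.exp (t - s) * u t = Ψ (Real.exp t) / Real.exp s := by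
        simp only [hu]; rw [Real.exp_sub]
        have := Real.exp_ne_zero t; have := Real.exp_ne_zero s
        field_simp
      rw [h]
      exact div_le_div_of_nonneg_right (hΨmono (Real.exp_le_exp.2 hst)) (Real.exp_pos s).le
    · intro s hs
      have hs0 : s ≠ 0 := by rintro rfl; simp at hs
      have hs1 : s + 1 ≠ 0 := by
        intro h
        have := congrArg Complex.re h
        simp at this; linarith
      have hexp : IntegrableOn (fun t : ℝ => Complex.exp (-s * t)) (Ioi 0) :=
        integrableOn_exp_mul_complex_Ioi (by simpa using hs) 0
      have hint : Integrable (fun t : ℝ => (u t : ℂ) * Complex.exp (-s * t))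
          (volume.restrict (Ioi 0)) := by
        refine Integrable.bdd_mul (c := Real.log 4 + 4) hexp
          (Measurable.aestronglyMeasurable (by fun_prop)) (.of_forall fun t => ?_)
        rw [Complex.norm_real, Real.norm_of_nonneg (hu0 t)]
        exact hub t
      have h1 : ∫ t in Ioi (0 : ℝ), ((u t - A : ℝ) : ℂ) * Complex.exp (-s * t) =
          (∫ t in Ioi (0 : ℝ), (u t : ℂ) * Complex.exp (-s * t)) - A / s := by
        have e : (fun t : ℝ => ((u t - A : ℝ) : ℂ) * Complex.exp (-s * t)) =
            fun t : ℝ => (u t : ℂ) * Complex.exp (-s * t) - A * Complex.exp (-s * t) := by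
          ext t; push_cast; ring
        rw [e, integral_sub hint (hexp.integrable.const_mul _), integral_const_mul,
          integral_exp_mul_complex_Ioi (by simpa using hs)]
        simp [div_eq_mul_inv]
      have h2 := LSeries_residueClass_eq_laplace a hs
      have h3 := eqOn_LFunctionResidueClassAux ha (x := s + 1) (by simpa using hs)
      simp only [add_sub_cancel_right] at h3
      rw [h1, eq_div_iff hs1, h3, h2]
      have hAc : ((q.totient : ℂ))⁻¹ = (A : ℂ) := by rw [hA]; push_cast; rfl
      rw [hAc]
      simp only [hu, hΨ]
      field_simp
      ring
    · refine ContinuousOn.div ?_ (by fun_prop) ?_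
      · refine ContinuousOn.sub ?_ continuousOn_const
        exact (continuousOn_LFunctionResidueClassAux a).comp (by fun_prop) fun s hs => by
          simpa using hs
      · intro s hs h
        have := congrArg Complex.re h
        simp at this hs
        linarith
  refine (key.comp (Real.tendsto_log_atTop.comp tendsto_natCast_atTop_atTop)).congr' ?_
  filter_upwards [eventually_gt_atTop 0] with n hn
  have : (0 : ℝ) < n := by exact_mod_cast hn
  simp [hu, hΨ, Real.exp_log this]

open ArithmeticFunction.vonMangoldt Set Topology in
/-- The prime number theorem in arithmetic progressions, for Chebyshev's function `θ`. -/
theorem tendsto_sum_log_prime_mod_div {q : ℕ} [NeZero q] {a : ZMod q} (ha : IsUnit a) :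
    Tendsto (fun n : ℕ => (∑ p ∈ Finset.range (n + 1) with Nat.Prime p ∧ (Nat.cast p : ZMod q) = a,
      Real.log p) / (n : ℝ)) atTop (𝓝 ((q.totient : ℝ)⁻¹)) := by
  obtain ⟨C, hC⟩ := Chebyshev.psi_sub_theta_le_mul_sqrt
  have hrw : ∀ n : ℕ, ∑ p ∈ Finset.range (n + 1) with Nat.Prime p ∧ (Nat.cast p : ZMod q) = a, Real.log p =
      ∑ k ∈ Finset.Icc 1 n, if k.Prime then residueClass a k else 0 := by
    intro n
    rw [← Finset.sum_filter]
    refine Finset.sum_subset_zero_on_sdiff ?_ ?_ ?_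
    · intro p hp
      simp only [Finset.mem_filter, Finset.mem_range, Finset.mem_Icc] at hp ⊢
      exact ⟨⟨hp.2.1.one_le, by omega⟩, hp.2.1⟩
    · intro p hp
      simp only [Finset.mem_sdiff, Finset.mem_filter, Finset.mem_range, Finset.mem_Icc] at hp
      refine indicator_of_notMem (s := {n : ℕ | (n : ZMod q) = a}) (fun h => hp.2 ⟨by omega, hp.1.2, h⟩) _
    · intro p hp
      simp only [Finset.mem_filter, Finset.mem_range] at hp
      rw [residueClass, indicator_of_mem (by exact hp.2.2),
        ArithmeticFunction.vonMangoldt_apply_prime hp.2.1]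
  -- Proper prime powers in the class contribute at most `ψ - θ`, which is `O(√n)`.
  have hdiff : ∀ n : ℕ, 0 ≤ (∑ k ∈ Finset.Icc 1 n, residueClass a k) -
        ∑ p ∈ Finset.range (n + 1) with Nat.Prime p ∧ (Nat.cast p : ZMod q) = a, Real.log p ∧
      (∑ k ∈ Finset.Icc 1 n, residueClass a k) -
        ∑ p ∈ Finset.range (n + 1) with Nat.Prime p ∧ (Nat.cast p : ZMod q) = a, Real.log p ≤ C * √n := by
    intro n
    rw [hrw, ← Finset.sum_sub_distrib]
    constructor
    · refine Finset.sum_nonneg fun k _ => ?_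
      split_ifs
      · simp
      · simpa using residueClass_nonneg a k
    · refine le_trans ?_ (hC n)
      rw [Chebyshev.psi, Chebyshev.theta, Nat.floor_natCast, Finset.sum_filter,
        ← Finset.sum_sub_distrib]
      refine Finset.sum_le_sum fun k _ => ?_
      split_ifs with hk
      · simp [ArithmeticFunction.vonMangoldt_apply_prime hk]
      · simpa using residueClass_le a k
  have hsq : Tendsto (fun n : ℕ => C * (√n / n)) atTop (𝓝 (C * 0)) := by
    refine Tendsto.const_mul _ ?_
    have : Tendsto (fun n : ℕ => (√(n : ℝ))⁻¹) atTop (𝓝 0) :=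
      (Real.tendsto_sqrt_atTop.comp tendsto_natCast_atTop_atTop).inv_tendsto_atTop
    refine this.congr fun n => ?_
    rw [Real.sqrt_div_self]
  rw [mul_zero] at hsq
  have hz : Tendsto (fun n : ℕ => ((∑ k ∈ Finset.Icc 1 n, residueClass a k) -
        ∑ p ∈ Finset.range (n + 1) with Nat.Prime p ∧ (Nat.cast p : ZMod q) = a, Real.log p) / (n : ℝ))
      atTop (𝓝 0) := by
    refine squeeze_zero (fun n => div_nonneg (hdiff n).1 (Nat.cast_nonneg n)) (fun n => ?_) hsq
    rw [← mul_div_assoc]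
    exact div_le_div_of_nonneg_right (hdiff n).2 (Nat.cast_nonneg n)
  have := (tendsto_sum_residueClass_div ha).sub hz
  rw [sub_zero] at this
  refine this.congr fun n => ?_
  ring

/-! ### Primes congruent to `n` modulo a prime square. -/

/-- The sum of `log p` over the primes `p ≤ n` with `p ≡ n` modulo `m`. -/
noncomputable def primeLogSum (n m : ℕ) : ℝ :=
  ∑ p ∈ Finset.range (n + 1) with p.Prime ∧ m ∣ n - p, Real.log p

theorem log_prime_nonneg {p : ℕ} (hp : p.Prime) : 0 ≤ Real.log p :=
  Real.log_nonneg (by exact_mod_cast hp.one_le)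

/-- Multiplying by an inverse `b` of `q` modulo `M` turns the progression into the consecutive
integers `b n - j`, and a product of `J` consecutive integers is divisible by `J!`. -/
theorem dvd_prod_arith_progression {n q J M : ℕ} (hM : M ∣ J.factorial) (hco : M.Coprime q)
    (hJ : ∀ j < J, q * j ≤ n) : M ∣ ∏ j ∈ Finset.range J, (n - q * j) := by
  have hM0 : 0 < M := Nat.pos_of_dvd_of_pos hM J.factorial_pos
  obtain ⟨b, hb⟩ : ∃ b : ℕ, (b : ZMod M) * q = 1 := by
    have : NeZero M := ⟨hM0.ne'⟩
    have hu : IsUnit (q : ZMod M) := (ZMod.isUnit_iff_coprime q M).2 hco.symm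
    obtain ⟨v, hv⟩ := hu.exists_left_inv
    exact ⟨v.val, by rw [ZMod.natCast_zmod_val, hv]⟩
  have hbu : IsUnit (b : ZMod M) := IsUnit.of_mul_eq_one _ hb
  rw [← ZMod.natCast_eq_zero_iff]
  -- The summand `M * J` vanishes modulo `M` and keeps the natural-number subtractions from
  -- truncating.
  have h0 : (((b * n + M * J).descFactorial J : ℕ) : ZMod M) = 0 :=
    (ZMod.natCast_eq_zero_iff _ _).2 (hM.trans (Nat.factorial_dvd_descFactorial _ _))
  rw [Nat.descFactorial_eq_prod_range, Nat.cast_prod] at h0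
  have h1 : (b : ZMod M) ^ J * ((∏ j ∈ Finset.range J, (n - q * j) : ℕ) : ZMod M) = 0 := by
    rw [← h0, Nat.cast_prod, ← Finset.card_range J, ← Finset.prod_const, Finset.card_range,
      ← Finset.prod_mul_distrib]
    refine Finset.prod_congr rfl fun j hj => ?_
    rw [Finset.mem_range] at hj
    have h2 : j ≤ b * n + M * J := by nlinarith [Nat.zero_le (b * n)]
    rw [Nat.cast_sub (hJ j hj), Nat.cast_sub h2]
    push_cast
    rw [ZMod.natCast_self]
    linear_combination (-(j : ZMod M)) * hb
  exact (hbu.pow J).mul_right_eq_zero.1 h1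

theorem mul_log_sub_le_log_factorial (J : ℕ) :
    (J : ℝ) * Real.log J - J ≤ Real.log J.factorial := by
  rcases Nat.eq_zero_or_pos J with rfl | hJ
  · simp
  have hJ0 : (0 : ℝ) < J := by exact_mod_cast hJ
  have hf : (0 : ℝ) < J.factorial := by exact_mod_cast J.factorial_pos
  have h := Real.log_le_log (by positivity) (Real.pow_div_factorial_le_exp J hJ0.le J)
  rw [Real.log_exp, Real.log_div (by positivity) hf.ne', Real.log_pow] at h
  linarith

/-- An elementary upper bound of Chebyshev type for the primes in a class modulo `r²`. -/
theorem primeLogSum_sq_le {n r : ℕ} (hr : r.Prime) (hrn : ¬ r ∣ n) (hle : r ^ 2 ≤ n) :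
    primeLogSum n (r ^ 2) ≤ 2 * (n : ℝ) / (r : ℝ) ^ 2 * (3 * Real.log r + 3) := by
  have := Fact.mk hr
  have hr0 : 0 < r ^ 2 := pow_pos hr.pos 2
  have hn0 : 0 < n := hr0.trans_le hle
  -- `J` counts the `j ≥ 0` with `r² j ≤ n`, so every prime in question is a factor `n - r² j` of
  -- the product `P` below.
  set J := n / r ^ 2 + 1 with hJ
  have hJpos : 0 < J := Nat.succ_pos _
  have hJn : ∀ j < J, r ^ 2 * j ≤ n := fun j hj => by
    have : j ≤ n / r ^ 2 := by omega
    calc r ^ 2 * j ≤ r ^ 2 * (n / r ^ 2) := Nat.mul_le_mul_left _ this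
      _ ≤ n := Nat.mul_div_le n _
  have hnJ : n ≤ J * r ^ 2 := by
    have := Nat.div_add_mod n (r ^ 2)
    have := Nat.mod_lt n hr0
    rw [hJ]; nlinarith
  obtain ⟨v, M, hMr, hfac⟩ := Nat.exists_eq_pow_mul_and_not_dvd J.factorial_ne_zero r hr.ne_one
  have hM0 : M ≠ 0 := by rintro rfl; simp at hMr
  have hv : v ≤ J := by
    have h1 : padicValNat r J.factorial = v := by
      rw [hfac, padicValNat.mul (pow_ne_zero _ hr.ne_zero) hM0, padicValNat.prime_pow,
        padicValNat.eq_zero_of_not_dvd hMr, add_zero]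
    have h2 := sub_one_mul_padicValNat_factorial_lt_of_ne_zero r hJpos.ne'
    rw [h1] at h2
    have : 1 ≤ r - 1 := by have := hr.two_le; omega
    nlinarith
  have hMco : M.Coprime (r ^ 2) := ((Nat.Prime.coprime_iff_not_dvd hr).2 hMr).symm.pow_right 2
  set P := ∏ j ∈ Finset.range J, (n - r ^ 2 * j) with hP
  have hMP : M ∣ P := dvd_prod_arith_progression (hfac ▸ Dvd.intro_left _ rfl) hMco hJn
  -- Primes above `J` are coprime to `M`, the part of `J!` prime to `r`. Hence `M * ∏ p` divides `P
  -- ≤ n ^ J`, and the factor `M` saves almost all of `J log J`.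
  set S := (Finset.range (n + 1)).filter fun p => (p.Prime ∧ r ^ 2 ∣ n - p) ∧ J < p with hS
  have hSP : ∏ p ∈ S, p ∣ P := by
    refine Finset.prod_primes_dvd _ (fun p hp => ?_) fun p hp => ?_
    · exact (Finset.mem_filter.1 hp).2.1.1.prime
    · rw [hS, Finset.mem_filter, Finset.mem_range] at hp
      obtain ⟨hpn, ⟨hpp, j, hj⟩, hpJ⟩ := hp
      have hjJ : j < J := by
        rw [hJ, Nat.lt_succ_iff, Nat.le_div_iff_mul_le hr0, mul_comm, ← hj]
        exact Nat.sub_le _ _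
      have : p = n - r ^ 2 * j := by omega
      rw [this]
      exact Finset.dvd_prod_of_mem (fun j => n - r ^ 2 * j) (Finset.mem_range.2 hjJ)
  have hco : M.Coprime (∏ p ∈ S, p) := by
    refine Nat.Coprime.prod_right fun p hp => ?_
    have hp' := (Finset.mem_filter.1 hp).2
    refine ((Nat.Prime.coprime_iff_not_dvd hp'.1.1).2 fun h => ?_).symm
    have : p ∣ J.factorial := h.trans (hfac ▸ Dvd.intro_left _ rfl)
    exact absurd ((hp'.1.1.dvd_factorial).1 this) (by omega)
  have hdvd : M * ∏ p ∈ S, p ∣ P := hco.mul_dvd_of_dvd_of_dvd hMP hSP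
  -- No factor is zero, since `r² j = n` would force `r ∣ n`.
  have hPpos : 0 < P := Finset.prod_pos fun j hj => by
    refine Nat.sub_pos_of_lt (lt_of_le_of_ne (hJn j (Finset.mem_range.1 hj)) fun h => hrn ?_)
    rw [← h]
    exact (dvd_pow_self r two_ne_zero).mul_right j
  have hPle : P ≤ n ^ J := by
    calc P ≤ ∏ _j ∈ Finset.range J, n := Finset.prod_le_prod' fun j _ => Nat.sub_le _ _
      _ = n ^ J := by simp
  have hSpos : ∀ p ∈ S, p ≠ 0 := fun p hp => (Finset.mem_filter.1 hp).2.1.1.ne_zero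
  have hnat : M * ∏ p ∈ S, p ≤ n ^ J := (Nat.le_of_dvd hPpos hdvd).trans hPle
  have hlog : Real.log M + ∑ p ∈ S, Real.log p ≤ J * Real.log n := by
    have hprod : (0 : ℝ) < ∏ p ∈ S, (p : ℝ) :=
      Finset.prod_pos fun p hp => by exact_mod_cast Nat.pos_of_ne_zero (hSpos p hp)
    have hM0' : (0 : ℝ) < M := by exact_mod_cast Nat.pos_of_ne_zero hM0
    have hcast := (Nat.cast_le (α := ℝ)).2 hnat
    push_cast at hcast
    have := Real.log_le_log (by positivity) hcast
    rwa [Real.log_mul hM0'.ne' hprod.ne', Real.log_prod (fun p hp => by exact_mod_cast hSpos p hp),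
      Real.log_pow] at this
  have hlogM : Real.log J.factorial = v * Real.log r + Real.log M := by
    rw [hfac]; push_cast
    rw [Real.log_mul (by have := hr.ne_zero; positivity) (by exact_mod_cast hM0), Real.log_pow]
  have hlogr : 0 ≤ Real.log r := log_prime_nonneg hr
  have hJ0 : (0 : ℝ) < J := by exact_mod_cast hJpos
  have hr0' : (0 : ℝ) < r := by exact_mod_cast hr.pos
  have hn0' : (0 : ℝ) < n := by exact_mod_cast hn0
  have hlogn : Real.log n ≤ Real.log J + 2 * Real.log r := by
    have : (n : ℝ) ≤ J * (r : ℝ) ^ 2 := by exact_mod_cast hnJ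
    have := Real.log_le_log hn0' this
    rw [Real.log_mul hJ0.ne' (by positivity), Real.log_pow] at this
    exact_mod_cast this
  have hvJ : (v : ℝ) * Real.log r ≤ J * Real.log r :=
    mul_le_mul_of_nonneg_right (by exact_mod_cast hv) hlogr
  -- The terms `J log J` cancel; `2 log r` comes from `log n`, one more from the power of `r` in
  -- `J!`, and `1` from Stirling's bound.
  have hS1 : ∑ p ∈ S, Real.log p ≤ J * (3 * Real.log r + 1) := by
    have := mul_log_sub_le_log_factorial J
    have := mul_le_mul_of_nonneg_left hlogn hJ0.le
    linarith
  have htheta : ∑ p ∈ (Finset.range (n + 1)).filter fun p => (p.Prime ∧ r ^ 2 ∣ n - p) ∧ ¬ J < p,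
      Real.log p ≤ 2 * J := by
    refine le_trans ?_ (show Chebyshev.theta J ≤ 2 * J from ?_)
    · rw [Chebyshev.theta_eq_sum_Icc, Nat.floor_natCast]
      refine Finset.sum_le_sum_of_subset_of_nonneg (fun p hp => ?_) fun p hp _ =>
        log_prime_nonneg (Finset.mem_filter.1 hp).2
      simp only [Finset.mem_filter, Finset.mem_range, Finset.mem_Icc] at hp ⊢
      exact ⟨⟨Nat.zero_le _, by omega⟩, hp.2.1.1⟩
    · refine (Chebyshev.theta_le_log4_mul_x hJ0.le).trans ?_
      refine mul_le_mul_of_nonneg_right ?_ hJ0.le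
      rw [show (4 : ℝ) = 2 ^ 2 by norm_num, Real.log_pow]
      have := Real.log_two_lt_d9
      push_cast; linarith
  have htot : primeLogSum n (r ^ 2) ≤ J * (3 * Real.log r + 3) := by
    rw [primeLogSum, ← Finset.sum_filter_add_sum_filter_not _ (fun p => J < p),
      Finset.filter_filter, Finset.filter_filter]
    linarith
  have hJle : (J : ℝ) ≤ 2 * n / (r : ℝ) ^ 2 := by
    rw [le_div_iff₀ (by positivity)]
    have : J * r ^ 2 ≤ 2 * n := by
      have := Nat.div_mul_le_self n (r ^ 2)
      rw [hJ]; nlinarith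
    exact_mod_cast this
  exact htot.trans (mul_le_mul_of_nonneg_right hJle (by linarith))

/-! ### Class densities and the sieve by finitely many moduli. -/

/-- The density of the primes `p` with `p ≡ n` modulo `m`. -/
noncomputable def classDensity (n m : ℕ) : ℝ := if n.Coprime m then (m.totient : ℝ)⁻¹ else 0

theorem primeLogSum_nonneg (n m : ℕ) : 0 ≤ primeLogSum n m :=
  Finset.sum_nonneg fun _ hp => log_prime_nonneg (Finset.mem_filter.1 hp).2.1

theorem primeLogSum_eq_of_coprime (n m : ℕ) : primeLogSum n m =
    ∑ p ∈ Finset.range (n + 1) with Nat.Prime p ∧ (Nat.cast p : ZMod m) = n, Real.log p := by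
  rw [primeLogSum]
  congr 1
  refine Finset.filter_congr fun p hp => and_congr_right fun _ => ?_
  have hpn : p ≤ n := by have := Finset.mem_range.1 hp; omega
  rw [ZMod.natCast_eq_natCast_iff, Nat.modEq_iff_dvd' hpn]

/-- A common prime factor of `n` and `m` divides `p`, hence equals `p`. -/
theorem primeLogSum_le_of_not_coprime {n m : ℕ} (hm : m ≠ 0) (h : ¬ n.Coprime m) :
    primeLogSum n m ≤ ∑ p ∈ m.primeFactors, Real.log p := by
  refine Finset.sum_le_sum_of_subset_of_nonneg (fun p hp => ?_) fun p hp _ =>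
    log_prime_nonneg (Nat.prime_of_mem_primeFactors hp)
  rw [Finset.mem_filter, Finset.mem_range] at hp
  obtain ⟨hpn, hpp, hdvd⟩ := hp
  obtain ⟨l, hl, hln, hlm⟩ := Nat.Prime.not_coprime_iff_dvd.1 h
  have hlp : l ∣ p := by
    have := (Nat.dvd_sub_iff_right (by omega) hln).1 (hlm.trans hdvd)
    exact this
  rw [(Nat.prime_dvd_prime_iff_eq hl hpp).1 hlp] at hlm
  exact Nat.mem_primeFactors.2 ⟨hpp, hlm, hm⟩

-- The class of `n` moves with `n`, but there are only finitely many classes modulo `m`, so the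
-- limits hold simultaneously in all unit classes.
open Topology in
theorem tendsto_primeLogSum_sub {m : ℕ} (hm : m ≠ 0) :
    Tendsto (fun n : ℕ => primeLogSum n m / n - classDensity n m) atTop (𝓝 0) := by
  have : NeZero m := ⟨hm⟩
  rw [Metric.tendsto_nhds]
  intro ε hε
  have h1 : ∀ a : ZMod m, ∀ᶠ n : ℕ in atTop, IsUnit a →
      |(∑ p ∈ Finset.range (n + 1) with Nat.Prime p ∧ (Nat.cast p : ZMod m) = a,
        Real.log p) / (n : ℝ) - (m.totient : ℝ)⁻¹| < ε := by
    intro a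
    by_cases ha : IsUnit a
    · filter_upwards [Metric.tendsto_nhds.1 (tendsto_sum_log_prime_mod_div ha) ε hε] with n hn _
      exact hn
    · exact .of_forall fun n h => absurd h ha
  have h2 : ∀ᶠ n : ℕ in atTop, (∑ p ∈ m.primeFactors, Real.log p) / (n : ℝ) < ε :=
    (tendsto_const_div_atTop_nhds_zero_nat _).eventually_lt_const hε
  filter_upwards [eventually_all.2 h1, h2] with n hn1 hn2
  rw [Real.dist_eq, sub_zero, classDensity]
  split_ifs with hco
  · rw [primeLogSum_eq_of_coprime]
    exact hn1 n ((ZMod.isUnit_iff_coprime n m).2 hco)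
  · rw [sub_zero, abs_of_nonneg (div_nonneg (primeLogSum_nonneg n m) n.cast_nonneg)]
    exact (div_le_div_of_nonneg_right (primeLogSum_le_of_not_coprime hm hco)
      n.cast_nonneg).trans_lt hn2

theorem classDensity_prod (n : ℕ) {S : Finset ℕ} {m : ℕ → ℕ}
    (hco : (S : Set ℕ).Pairwise fun i j => (m i).Coprime (m j)) :
    classDensity n (∏ q ∈ S, m q) = ∏ q ∈ S, classDensity n (m q) := by
  induction S using Finset.induction_on with
  | empty => simp [classDensity]
  | insert a S ha ih =>
    have hS : (S : Set ℕ).Pairwise fun i j => (m i).Coprime (m j) :=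
      hco.mono (by simp)
    rw [Finset.prod_insert ha, Finset.prod_insert ha, ← ih hS]
    have hc : (m a).Coprime (∏ q ∈ S, m q) := Nat.Coprime.prod_right fun q hq =>
      hco (by simp) (by simp [hq]) (by rintro rfl; exact ha hq)
    simp only [classDensity, Nat.coprime_mul_iff_right, Nat.totient_mul hc]
    generalize ∏ q ∈ S, m q = P
    by_cases h1 : n.Coprime (m a)
    · by_cases h2 : n.Coprime P
      · rw [if_pos h1, if_pos h2, if_pos ⟨h1, h2⟩, Nat.cast_mul, mul_inv]
      · rw [if_neg h2, if_neg (fun h => h2 h.2), mul_zero]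
    · rw [if_neg h1, if_neg (fun h => h1 h.1), zero_mul]

/-- The sum of `log p` over the primes `p ≤ n` such that `n - p` is not divisible by any
`m q`, `q ∈ Q`. -/
noncomputable def sievedLogSum (Q : Finset ℕ) (m : ℕ → ℕ) (n : ℕ) : ℝ :=
  ∑ p ∈ Finset.range (n + 1) with p.Prime, (if ∀ q ∈ Q, ¬ m q ∣ n - p then 1 else 0) * Real.log p

/-- Expand the product of `1 - 1_{m q ∣ x}`; coprimality merges simultaneous divisibilities into
one. -/
theorem ite_forall_not_dvd {Q : Finset ℕ} {m : ℕ → ℕ}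
    (hco : (Q : Set ℕ).Pairwise fun i j => (m i).Coprime (m j)) (x : ℕ) :
    (if ∀ q ∈ Q, ¬ m q ∣ x then (1 : ℝ) else 0) =
      ∑ S ∈ Q.powerset, (-1) ^ S.card * if (∏ q ∈ S, m q) ∣ x then 1 else 0 := by
  have h1 : (if ∀ q ∈ Q, ¬ m q ∣ x then (1 : ℝ) else 0) =
      ∏ q ∈ Q, (1 - if m q ∣ x then (1 : ℝ) else 0) := by
    have : ∀ q, (1 - if m q ∣ x then (1 : ℝ) else 0) = if ¬ m q ∣ x then 1 else 0 := by
      intro q; split_ifs <;> simp_all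
    simp_rw [this, Finset.prod_ite_zero, Finset.prod_const_one]
  rw [h1, Finset.prod_sub]
  refine Finset.sum_congr rfl fun S hS => ?_
  rw [Finset.prod_const_one, mul_one, Finset.prod_ite_zero, Finset.prod_const_one]
  congr 2
  refine propext ⟨fun h => ?_, fun h q hq => (Finset.dvd_prod_of_mem m hq).trans h⟩
  refine Finset.prod_dvd_of_isRelPrime (fun i hi j hj hij => ?_) h
  exact (Nat.coprime_iff_isRelPrime).1
    (hco (Finset.mem_powerset.1 hS hi) (Finset.mem_powerset.1 hS hj) hij)

theorem sievedLogSum_eq {Q : Finset ℕ} {m : ℕ → ℕ}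
    (hco : (Q : Set ℕ).Pairwise fun i j => (m i).Coprime (m j)) (n : ℕ) :
    sievedLogSum Q m n = ∑ S ∈ Q.powerset, (-1) ^ S.card * primeLogSum n (∏ q ∈ S, m q) := by
  simp_rw [sievedLogSum, ite_forall_not_dvd hco, Finset.sum_mul]
  rw [Finset.sum_comm]
  refine Finset.sum_congr rfl fun S _ => ?_
  rw [primeLogSum, ← Finset.filter_filter, Finset.sum_filter _ (fun p : ℕ => Real.log p),
    Finset.mul_sum]
  refine Finset.sum_congr rfl fun p _ => ?_
  split_ifs <;> simp

open Topology in
theorem tendsto_sievedLogSum_sub {Q : Finset ℕ} {m : ℕ → ℕ} (hm : ∀ q ∈ Q, m q ≠ 0)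
    (hco : (Q : Set ℕ).Pairwise fun i j => (m i).Coprime (m j)) :
    Tendsto (fun n : ℕ => sievedLogSum Q m n / n - ∏ q ∈ Q, (1 - classDensity n (m q)))
      atTop (𝓝 0) := by
  have h : Tendsto (fun n : ℕ => ∑ S ∈ Q.powerset, (-1 : ℝ) ^ S.card *
      (primeLogSum n (∏ q ∈ S, m q) / n - classDensity n (∏ q ∈ S, m q))) atTop
      (𝓝 (∑ S ∈ Q.powerset, (-1 : ℝ) ^ S.card * 0)) := by
    refine tendsto_finsetSum _ fun S hS => (tendsto_primeLogSum_sub ?_).const_mul _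
    exact Finset.prod_ne_zero_iff.2 fun q hq => hm q (Finset.mem_powerset.1 hS hq)
  simp only [mul_zero, Finset.sum_const_zero] at h
  refine h.congr fun n => ?_
  rw [sievedLogSum_eq hco, Finset.prod_sub, Finset.sum_div, ← Finset.sum_sub_distrib]
  refine Finset.sum_congr rfl fun S hS => ?_
  rw [classDensity_prod n (hco.mono (by simpa using Finset.mem_powerset.1 hS)),
    Finset.prod_const_one]
  ring

/-! ### Truncating the squarefree condition and bounding the tail. -/

/-- The modulus `q` or `q²` by which `n - p` must not be divisible. -/
def sieveModulus (k q : ℕ) : ℕ := if q ∣ k then q else q ^ 2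

/-- Since `k ≤ y`, all primes dividing `k` are among the small ones, and for those the test by `q`
subsumes the test by `q²`. -/
theorem gcd_eq_one_and_squarefree_iff {k y x : ℕ} (hk0 : k ≠ 0) (hk : k ≤ y) :
    (Nat.gcd x k = 1 ∧ Squarefree x) ↔
      (∀ q ∈ (Finset.range (y + 1)).filter Nat.Prime, ¬ sieveModulus k q ∣ x) ∧
        ∀ q, q.Prime → y < q → ¬ q ^ 2 ∣ x := by
  constructor
  · rintro ⟨hg, hsq⟩
    have hsq' : ∀ q : ℕ, q.Prime → ¬ q ^ 2 ∣ x := fun q hq h => by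
      have := Nat.isUnit_iff.1 (hsq q (by rwa [← sq]))
      exact hq.ne_one this
    refine ⟨fun q hq h => ?_, fun q hq _ => hsq' q hq⟩
    have hqp := (Finset.mem_filter.1 hq).2
    rw [sieveModulus] at h
    split_ifs at h with hqk
    · have := Nat.dvd_gcd h hqk
      rw [hg] at this
      exact hqp.one_lt.ne' (Nat.dvd_one.1 this)
    · exact hsq' q hqp h
  · rintro ⟨h1, h2⟩
    constructor
    · by_contra hg
      obtain ⟨q, hq, hqx, hqk⟩ := Nat.Prime.not_coprime_iff_dvd.1 hg
      refine h1 q ?_ ?_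
      · have := Nat.le_of_dvd (Nat.pos_of_ne_zero hk0) hqk
        simp [hq]; omega
      · rwa [sieveModulus, if_pos hqk]
    · rw [Nat.squarefree_iff_prime_squarefree]
      intro q hq h
      rw [← sq] at h
      rcases le_or_gt q y with hqy | hqy
      · refine h1 q (by simp [hq]; omega) ?_
        rw [sieveModulus]
        split_ifs
        exacts [(dvd_pow_self q two_ne_zero).trans h, h]
      · exact h2 q hq hqy h

theorem primeSquarefreeCount_eq (k n : ℕ) : primeSquarefreeCount k n =
    ∑ p ∈ Finset.range (n + 1) with p.Prime,
      (if Nat.gcd (n - p) k = 1 ∧ Squarefree (n - p) then 1 else 0) * Real.log p := by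
  rw [primeSquarefreeCount, ← Finset.filter_filter, Finset.sum_filter (p := fun p =>
    Nat.gcd (n - p) k = 1)]
  refine Finset.sum_congr rfl fun p hp => ?_
  have hpn : p ≤ n := by have := Finset.mem_range.1 (Finset.mem_filter.1 hp).1; omega
  by_cases h1 : Nat.gcd (n - p) k = 1
  · by_cases h2 : Squarefree (n - p)
    · have h3 := (ArithmeticFunction.moebius_sq_eq_one_of_squarefree h2)
      have h4 : ((μ (n - p) : ℤ) : ℝ) ^ 2 = 1 := by exact_mod_cast h3
      rw [if_pos h1, if_pos ⟨h1, h2⟩, h4]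
    · simp [h1, h2, ArithmeticFunction.moebius_eq_zero_of_not_squarefree h2]
  · simp [h1]

/-- The primes `q` with `y < q` and `q² ≤ n`. -/
def largeModuli (y n : ℕ) : Finset ℕ :=
  (Finset.range (n + 1)).filter fun q => q.Prime ∧ y < q ∧ q ^ 2 ≤ n

theorem sievedLogSum_sub_primeSquarefreeCount {k y : ℕ} (hk0 : k ≠ 0) (hk : k ≤ y) (hy : 2 ≤ y)
    (n : ℕ) :
    0 ≤ sievedLogSum ((Finset.range (y + 1)).filter Nat.Prime) (sieveModulus k) n -
        primeSquarefreeCount k n ∧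
      sievedLogSum ((Finset.range (y + 1)).filter Nat.Prime) (sieveModulus k) n -
        primeSquarefreeCount k n ≤ ∑ q ∈ largeModuli y n, primeLogSum n (q ^ 2) := by
  have hsum : ∑ q ∈ largeModuli y n, primeLogSum n (q ^ 2) =
      ∑ p ∈ Finset.range (n + 1) with p.Prime,
        (∑ q ∈ largeModuli y n, if q ^ 2 ∣ n - p then (1 : ℝ) else 0) * Real.log p := by
    simp_rw [Finset.sum_mul]
    rw [Finset.sum_comm]
    refine Finset.sum_congr rfl fun q _ => ?_
    rw [primeLogSum, ← Finset.filter_filter, Finset.sum_filter _ (fun p : ℕ => Real.log p)]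
    refine Finset.sum_congr rfl fun p _ => ?_
    split_ifs <;> simp
  rw [hsum, primeSquarefreeCount_eq, sievedLogSum, ← Finset.sum_sub_distrib]
  have hpt : ∀ p ∈ (Finset.range (n + 1)).filter Nat.Prime,
      ((if Nat.gcd (n - p) k = 1 ∧ Squarefree (n - p) then (1 : ℝ) else 0) ≤
        if ∀ q ∈ (Finset.range (y + 1)).filter Nat.Prime, ¬ sieveModulus k q ∣ n - p
          then 1 else 0) ∧
      ((if ∀ q ∈ (Finset.range (y + 1)).filter Nat.Prime, ¬ sieveModulus k q ∣ n - p
          then (1 : ℝ) else 0) -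
        (if Nat.gcd (n - p) k = 1 ∧ Squarefree (n - p) then 1 else 0) ≤
        ∑ q ∈ largeModuli y n, if q ^ 2 ∣ n - p then 1 else 0) := by
    intro p _
    have hiff := gcd_eq_one_and_squarefree_iff (x := n - p) hk0 hk
    by_cases h1 : ∀ q ∈ (Finset.range (y + 1)).filter Nat.Prime, ¬ sieveModulus k q ∣ n - p
    · by_cases h2 : ∀ q, q.Prime → y < q → ¬ q ^ 2 ∣ n - p
      · rw [if_pos h1, if_pos (hiff.2 ⟨h1, h2⟩)]
        exact ⟨le_rfl, by simp⟩
      · rw [if_pos h1, if_neg (fun h => h2 (hiff.1 h).2), sub_zero]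
        refine ⟨zero_le_one, ?_⟩
        push Not at h2
        obtain ⟨q, hq, hyq, hdvd⟩ := h2
        -- The value `n - p = 0` is already removed by the test at `2`, which is present because `2
        -- ≤ y`.
        have hpos : 0 < n - p := by
          refine Nat.pos_of_ne_zero fun h0 => h1 2 (by simp [Nat.prime_two]; omega) ?_
          rw [h0]; exact dvd_zero _
        have hle : q ^ 2 ≤ n := (Nat.le_of_dvd hpos hdvd).trans (Nat.sub_le _ _)
        have hmem : q ∈ largeModuli y n := by
          refine Finset.mem_filter.2 ⟨Finset.mem_range.2 ?_, hq, hyq, hle⟩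
          nlinarith [hq.one_lt]
        refine le_trans ?_ (Finset.single_le_sum (f := fun q => if q ^ 2 ∣ n - p then (1 : ℝ) else 0)
          (fun q _ => by split_ifs <;> norm_num) hmem)
        simp [hdvd]
    · rw [if_neg h1, if_neg (fun h => h1 (hiff.1 h).1)]
      exact ⟨le_rfl, by simp⟩
  constructor
  · refine Finset.sum_nonneg fun p hp => ?_
    rw [← sub_mul]
    exact mul_nonneg (sub_nonneg.2 (hpt p hp).1) (log_prime_nonneg (Finset.mem_filter.1 hp).2)
  · refine Finset.sum_le_sum fun p hp => ?_
    rw [← sub_mul]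
    exact mul_le_mul_of_nonneg_right (hpt p hp).2 (log_prime_nonneg (Finset.mem_filter.1 hp).2)

theorem primeLogSum_sq_le_log {n r : ℕ} (hr : r.Prime) (hrn : r ∣ n) :
    primeLogSum n (r ^ 2) ≤ Real.log r := by
  have hnc : ¬ n.Coprime (r ^ 2) := fun h => by
    have := Nat.dvd_gcd hrn (dvd_pow_self r two_ne_zero)
    rw [h] at this
    exact hr.one_lt.ne' (Nat.dvd_one.1 this)
  refine (primeLogSum_le_of_not_coprime (pow_ne_zero 2 hr.ne_zero) hnc).trans ?_
  rw [Nat.primeFactors_prime_pow two_ne_zero hr, Finset.sum_singleton]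

theorem sum_log_primeFactors_le {n : ℕ} (hn : n ≠ 0) :
    ∑ p ∈ n.primeFactors, Real.log p ≤ Real.log n := by
  rw [← Real.log_prod fun p hp => by
    exact_mod_cast (Nat.prime_of_mem_primeFactors hp).ne_zero]
  have h := Nat.le_of_dvd (Nat.pos_of_ne_zero hn) (Nat.prod_primeFactors_dvd n)
  have h' := (Nat.cast_le (α := ℝ)).2 h
  push_cast at h'
  refine Real.log_le_log (Finset.prod_pos fun p hp => ?_) h'
  exact_mod_cast (Nat.prime_of_mem_primeFactors hp).pos

/-- The factor in the bound for the primes in a class modulo `q²`. -/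
noncomputable def tailWeight (q : ℕ) : ℝ := 2 / (q : ℝ) ^ 2 * (3 * Real.log q + 3)

theorem tailWeight_nonneg (q : ℕ) : 0 ≤ tailWeight q := by
  have := Real.log_natCast_nonneg q
  unfold tailWeight; positivity

/-- The bound `log q ≤ 2 √q` gives `2 (3 log q + 3) ≤ 18 √q`, hence comparison with `q ^ (-3/2)`. -/
theorem summable_tailWeight : Summable tailWeight := by
  have hs : Summable fun q : ℕ => 18 * (1 / (q : ℝ) ^ (3 / 2 : ℝ)) :=
    (Real.summable_one_div_nat_rpow.2 (by norm_num)).mul_left 18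
  refine Summable.of_nonneg_of_le tailWeight_nonneg (fun q => ?_) hs
  rcases Nat.eq_zero_or_pos q with rfl | hq
  · simp [tailWeight]
  have hq1 : (1 : ℝ) ≤ q := by exact_mod_cast hq
  have hq0 : (0 : ℝ) < q := by linarith
  have h1 : Real.log q ≤ (q : ℝ) ^ (1 / 2 : ℝ) / (1 / 2) :=
    Real.log_le_rpow_div hq0.le (by norm_num)
  have h2 : (1 : ℝ) ≤ (q : ℝ) ^ (1 / 2 : ℝ) := Real.one_le_rpow hq1 (by norm_num)
  have h3 : (q : ℝ) ^ (1 / 2 : ℝ) * (q : ℝ) ^ (3 / 2 : ℝ) = (q : ℝ) ^ 2 := by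
    rw [← Real.rpow_add hq0]; norm_num
  have h4 : 0 < (q : ℝ) ^ (3 / 2 : ℝ) := Real.rpow_pos_of_pos hq0 _
  rw [tailWeight, ← h3, div_mul_eq_mul_div, mul_one_div, div_le_div_iff₀ (by positivity) h4]
  have : 2 * (3 * Real.log q + 3) ≤ 18 * (q : ℝ) ^ (1 / 2 : ℝ) := by linarith
  nlinarith

/-- The Chebyshev-type bound needs `q ∤ n`. When `q ∣ n` only `p = q` can occur, and all these cases
together contribute at most `log n`. -/
theorem sum_largeModuli_le (y : ℕ) {n : ℕ} (hn : n ≠ 0) :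
    ∑ q ∈ largeModuli y n, primeLogSum n (q ^ 2) ≤
      n * ∑ q ∈ largeModuli y n, tailWeight q + Real.log n := by
  have h1 : ∑ q ∈ largeModuli y n with q ∣ n, primeLogSum n (q ^ 2) ≤ Real.log n := by
    refine le_trans ?_ (sum_log_primeFactors_le hn)
    refine (Finset.sum_le_sum fun q hq => primeLogSum_sq_le_log
      (Finset.mem_filter.1 (Finset.mem_filter.1 hq).1).2.1 (Finset.mem_filter.1 hq).2).trans ?_
    refine Finset.sum_le_sum_of_subset_of_nonneg (fun q hq => ?_) fun p hp _ =>
      log_prime_nonneg (Nat.prime_of_mem_primeFactors hp)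
    rw [Finset.mem_filter, largeModuli, Finset.mem_filter] at hq
    exact Nat.mem_primeFactors.2 ⟨hq.1.2.1, hq.2, hn⟩
  have h2 : ∑ q ∈ largeModuli y n with ¬ q ∣ n, primeLogSum n (q ^ 2) ≤
      n * ∑ q ∈ largeModuli y n, tailWeight q := by
    rw [Finset.mul_sum]
    refine (Finset.sum_le_sum fun q hq => ?_).trans (Finset.sum_le_sum_of_subset_of_nonneg
      (Finset.filter_subset _ _) fun q _ _ => mul_nonneg n.cast_nonneg (tailWeight_nonneg q))
    rw [Finset.mem_filter, largeModuli, Finset.mem_filter] at hq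
    refine (primeLogSum_sq_le hq.1.2.1 hq.2 hq.1.2.2.2).trans (le_of_eq ?_)
    rw [tailWeight]; ring
  rw [← Finset.sum_filter_add_sum_filter_not _ (fun q => q ∣ n)]
  linarith

theorem exists_sum_largeModuli_tailWeight_lt {ε : ℝ} (hε : 0 < ε) :
    ∃ y₀ : ℕ, ∀ y ≥ y₀, ∀ n, ∑ q ∈ largeModuli y n, tailWeight q < ε := by
  obtain ⟨s, hs⟩ := summable_iff_vanishing_norm.1 summable_tailWeight ε hε
  refine ⟨s.sup id, fun y hy n => ?_⟩
  refine (le_abs_self _).trans_lt (hs _ (Finset.disjoint_left.2 fun q hq hqs => ?_))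
  have h1 : q ≤ s.sup id := Finset.le_sup (f := id) hqs
  have h2 := (Finset.mem_filter.1 hq).2.2.1
  omega

/-! ### Artin's constant and its Euler factors. -/

/-- The Euler factor of Artin's constant. -/
noncomputable def artinFactor (q : ℕ) : ℝ := 1 - 1 / ((q : ℝ) * ((q : ℝ) - 1))

theorem artinFactor_pos {q : ℕ} (hq : 2 ≤ q) : 0 < artinFactor q := by
  have h : (2 : ℝ) ≤ q := by exact_mod_cast hq
  rw [artinFactor, sub_pos, div_lt_one (by nlinarith)]
  nlinarith

theorem artinFactor_le_one {q : ℕ} (hq : 2 ≤ q) : artinFactor q ≤ 1 := by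
  have h : (2 : ℝ) ≤ q := by exact_mod_cast hq
  have : 0 ≤ 1 / ((q : ℝ) * ((q : ℝ) - 1)) :=
    one_div_nonneg.2 (mul_nonneg (by linarith) (by linarith))
  rw [artinFactor]; linarith

/-- The correction at `q ∣ n` undoes the Artin factor, as no condition remains there; the next
identity replaces it by the density of `q ∤ n - p`. -/
theorem artinFactor_mul_ramified {q : ℕ} (hq : 2 ≤ q) :
    artinFactor q * (1 + 1 / ((q : ℝ) ^ 2 - q - 1)) = 1 := by
  have h : (2 : ℝ) ≤ q := by exact_mod_cast hq
  have h1 : (q : ℝ) * (q - 1) - 1 ≠ 0 := by nlinarith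
  have h2 : (q : ℝ) - 1 ≠ 0 := by linarith
  have h3 : (q : ℝ) ≠ 0 := by linarith
  rw [artinFactor, show (q : ℝ) ^ 2 - q - 1 = q * (q - 1) - 1 by ring]; field_simp; ring

theorem artinFactor_mul_excluded {q : ℕ} (hq : 2 ≤ q) :
    artinFactor q * (1 - ((q : ℝ) - 1) / ((q : ℝ) ^ 2 - q - 1)) = 1 - 1 / ((q : ℝ) - 1) := by
  have h : (2 : ℝ) ≤ q := by exact_mod_cast hq
  have h1 : (q : ℝ) * (q - 1) - 1 ≠ 0 := by nlinarith
  have h2 : (q : ℝ) - 1 ≠ 0 := by linarith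
  have h3 : (q : ℝ) ≠ 0 := by linarith
  rw [artinFactor, show (q : ℝ) ^ 2 - q - 1 = q * (q - 1) - 1 by ring]; field_simp; ring

theorem prod_artinFactor_antitone {s t : Finset ℕ} (hst : s ⊆ t) (ht : ∀ q ∈ t, q.Prime) :
    ∏ q ∈ t, artinFactor q ≤ ∏ q ∈ s, artinFactor q := by
  rw [← Finset.prod_sdiff hst]
  refine mul_le_of_le_one_left (Finset.prod_nonneg fun q hq =>
    (artinFactor_pos (ht q (hst hq)).two_le).le) (Finset.prod_le_one (fun q hq => ?_) fun q hq => ?_)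
  · exact (artinFactor_pos (ht q (Finset.sdiff_subset hq)).two_le).le
  · exact artinFactor_le_one (ht q (Finset.sdiff_subset hq)).two_le

open Topology in
theorem tendsto_prod_artinFactor :
    Tendsto (fun y : ℕ => ∏ q ∈ (Finset.range (y + 1)).filter Nat.Prime, artinFactor q) atTop
      (𝓝 artinConstant) := by
  have h1 : Tendsto (fun y : ℕ => (Finset.range (y + 1)).subtype Nat.Prime) atTop atTop := by
    refine tendsto_atTop_finset_of_monotone (fun a b hab => ?_) fun p => ⟨p, ?_⟩
    · exact Finset.subtype_mono (Finset.range_subset_range.2 (by omega))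
    · simp
  refine ((hasProd_artinConstant.comp h1).congr fun y => ?_)
  rw [← Finset.prod_subtype_eq_prod_filter]
  rfl

/-- All Euler factors lie in `(0, 1]`, so adjoining further primes only decreases the product. -/
theorem artinConstant_le_prod {s : Finset ℕ} (hs : ∀ q ∈ s, q.Prime) :
    artinConstant ≤ ∏ q ∈ s, artinFactor q := by
  refine le_of_tendsto tendsto_prod_artinFactor ?_
  filter_upwards [eventually_ge_atTop (s.sup id)] with y hy
  refine prod_artinFactor_antitone (fun q hq => ?_) fun q hq => (Finset.mem_filter.1 hq).2
  have : q ≤ s.sup id := Finset.le_sup (f := id) hq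
  exact Finset.mem_filter.2 ⟨Finset.mem_range.2 (by omega), hs q hq⟩

/-- A limit of positive products is nonnegative; absolute convergence with nonzero factors excludes
`0`. -/
theorem artinConstant_pos : 0 < artinConstant := by
  refine lt_of_le_of_ne (ge_of_tendsto' tendsto_prod_artinFactor fun y =>
    Finset.prod_nonneg fun q hq => (artinFactor_pos (Finset.mem_filter.1 hq).2.two_le).le) ?_
  have h2 : Summable (fun p : Nat.Primes => 2 * (1 / ((p : ℕ) : ℝ) ^ 2)) :=
    ((Real.summable_one_div_nat_pow.mpr one_lt_two).comp_injective
      Nat.Primes.coe_nat_injective).mul_left 2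
  have hs : Summable fun p : Nat.Primes => ‖-(1 / ((p : ℝ) * ((p : ℝ) - 1)))‖ := by
    refine Summable.of_nonneg_of_le (fun p => norm_nonneg _) (fun p => ?_) h2
    have hp : (2 : ℝ) ≤ ((p : ℕ) : ℝ) := by exact_mod_cast p.2.two_le
    rw [norm_neg, Real.norm_of_nonneg (one_div_nonneg.2 (mul_nonneg (by linarith) (by linarith))),
      mul_one_div, div_le_div_iff₀ (by nlinarith) (by positivity)]
    nlinarith
  have := tprod_one_add_ne_zero_of_summable (fun p : Nat.Primes => ?_) hs
  · simp_rw [← sub_eq_add_neg] at this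
    exact this.symm
  · rw [← sub_eq_add_neg]
    exact (artinFactor_pos p.2.two_le).ne'

/-! ### Comparing the main term with the truncated product of densities. -/

/-- Squarefreeness makes `k / gcd(k, n)` coprime to `gcd(k, n)`, so the division removes the shared
primes entirely. -/
theorem primeFactors_coprimePart {k : ℕ} (hk : Squarefree k) (n : ℕ) :
    (coprimePart k n).primeFactors = k.primeFactors.filter fun q => ¬ q ∣ n := by
  have hk0 := hk.ne_zero
  have hmul : coprimePart k n * Nat.gcd k n = k := Nat.div_mul_cancel (Nat.gcd_dvd_left k n)
  have hc0 : coprimePart k n ≠ 0 := by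
    intro h; rw [h, zero_mul] at hmul; exact hk0 hmul.symm
  have hco : (coprimePart k n).Coprime (Nat.gcd k n) := by
    rw [← hmul] at hk
    exact Nat.coprime_of_squarefree_mul hk
  ext q
  simp only [Finset.mem_filter, Nat.mem_primeFactors]
  constructor
  · rintro ⟨hq, hd, -⟩
    have hdk : q ∣ k := hd.trans (Dvd.intro _ hmul)
    refine ⟨⟨hq, hdk, hk0⟩, fun hn => ?_⟩
    exact Nat.not_coprime_of_dvd_of_dvd hq.one_lt hd (Nat.dvd_gcd hdk hn) hco
  · rintro ⟨⟨hq, hdk, -⟩, hn⟩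
    refine ⟨hq, ?_, hc0⟩
    rw [← hmul] at hdk
    exact (hq.dvd_mul.1 hdk).resolve_right fun h => hn (h.trans (Nat.gcd_dvd_right k n))

theorem mainTerm_div (k : ℕ) {x : ℝ} {n : ℕ} (hn : 0 < n) (hx : x = n) :
    mainTerm k n / x =
      artinConstant * (∏ p ∈ n.primeFactors, (1 + 1 / ((p : ℝ) ^ 2 - p - 1))) *
        ∏ q ∈ k.primeFactors, (1 - ((q : ℝ) - 1) / ((q : ℝ) ^ 2 - q - 1)) := by
  have : (n : ℝ) ≠ 0 := by exact_mod_cast hn.ne'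
  rw [mainTerm, hx]; field_simp

theorem one_sub_classDensity_sieveModulus {k n q : ℕ} (hq : q.Prime) :
    1 - classDensity n (sieveModulus k q) =
      artinFactor q * (if q ∣ n then 1 + 1 / ((q : ℝ) ^ 2 - q - 1) else 1) *
        (if q ∣ k ∧ ¬ q ∣ n then 1 - ((q : ℝ) - 1) / ((q : ℝ) ^ 2 - q - 1) else 1) := by
  have hq1 : ((q - 1 : ℕ) : ℝ) = q - 1 := by rw [Nat.cast_sub hq.one_le, Nat.cast_one]
  have hco : n.Coprime (sieveModulus k q) ↔ ¬ q ∣ n := by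
    rw [← (Nat.Prime.coprime_iff_not_dvd hq), Nat.coprime_comm, sieveModulus]
    split_ifs
    · rfl
    · exact Nat.coprime_pow_left_iff two_pos _ _
  rw [classDensity]
  by_cases hn : q ∣ n
  · rw [if_neg (by rw [hco]; exact not_not.2 hn), if_pos hn, if_neg (fun h => h.2 hn),
      artinFactor_mul_ramified hq.two_le]
    norm_num
  · rw [if_pos (hco.2 hn), if_neg hn, mul_one]
    by_cases hk : q ∣ k
    · rw [if_pos ⟨hk, hn⟩, artinFactor_mul_excluded hq.two_le, sieveModulus, if_pos hk,
        Nat.totient_prime hq, hq1, one_div]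
    · rw [if_neg (fun h => hk h.1), mul_one, sieveModulus, if_neg hk,
        Nat.totient_prime_pow hq two_pos, artinFactor]
      push_cast
      rw [hq1]; simp

theorem classDensity_mem_Icc (n : ℕ) {m : ℕ} (hm : 0 < m) :
    0 ≤ 1 - classDensity n m ∧ 1 - classDensity n m ≤ 1 := by
  have h1 : (1 : ℝ) ≤ m.totient := by exact_mod_cast Nat.totient_pos.2 hm
  rw [classDensity]
  split_ifs
  · have := inv_le_one_of_one_le₀ h1
    have : 0 ≤ (m.totient : ℝ)⁻¹ := by positivity
    constructor <;> linarith
  · norm_num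

theorem sieveModulus_pos {k q : ℕ} (hq : q.Prime) : 0 < sieveModulus k q := by
  have := hq.pos
  rw [sieveModulus]; split_ifs <;> positivity

/-- The normalised main term is `D * (c E / cQ)`, where `E` collects the primes `p ∣ n` beyond `y`.
As `E` inverts their Artin factors `A'` and `c ≤ cQ A'`, the ratio lies in `[c / cQ, 1]` however
many such primes `n` has; together with `0 ≤ D ≤ 1` this gives a bound independent of `n`. -/
theorem abs_mainTerm_sub_prod_le {k y n : ℕ} (hk : Squarefree k) (hky : k ≤ y) (hn : 0 < n) :
    |mainTerm (coprimePart k n) n / n -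
      ∏ q ∈ (Finset.range (y + 1)).filter Nat.Prime, (1 - classDensity n (sieveModulus k q))| ≤
      (∏ q ∈ (Finset.range (y + 1)).filter Nat.Prime, artinFactor q - artinConstant) /
        artinConstant := by
  set Q := (Finset.range (y + 1)).filter Nat.Prime with hQ
  have hQp : ∀ q ∈ Q, q.Prime := fun q hq => (Finset.mem_filter.1 hq).2
  set c := artinConstant with hc
  set cQ := ∏ q ∈ Q, artinFactor q with hcQ
  have hc0 : 0 < c := artinConstant_pos
  have hcQ0 : 0 < cQ := Finset.prod_pos fun q hq => artinFactor_pos (hQp q hq).two_le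
  have hccQ : c ≤ cQ := artinConstant_le_prod hQp
  set D := ∏ q ∈ Q, (1 - classDensity n (sieveModulus k q)) with hD
  have hD0 : 0 ≤ D := Finset.prod_nonneg fun q hq =>
    (classDensity_mem_Icc n (sieveModulus_pos (hQp q hq))).1
  have hD1 : D ≤ 1 := Finset.prod_le_one
    (fun q hq => (classDensity_mem_Icc n (sieveModulus_pos (hQp q hq))).1)
    (fun q hq => (classDensity_mem_Icc n (sieveModulus_pos (hQp q hq))).2)
  set B : ℕ → ℝ := fun p => 1 + 1 / ((p : ℝ) ^ 2 - p - 1) with hB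
  set E := ∏ p ∈ n.primeFactors with ¬ p ≤ y, B p with hE
  set A' := ∏ p ∈ n.primeFactors with ¬ p ≤ y, artinFactor p with hA'
  have hlarge : ∀ p ∈ n.primeFactors.filter (fun p => ¬ p ≤ y), p.Prime := fun p hp =>
    Nat.prime_of_mem_primeFactors (Finset.mem_filter.1 hp).1
  have hA0 : 0 < A' := Finset.prod_pos fun p hp => artinFactor_pos (hlarge p hp).two_le
  have hA1 : A' ≤ 1 := Finset.prod_le_one
    (fun p hp => (artinFactor_pos (hlarge p hp).two_le).le)
    (fun p hp => artinFactor_le_one (hlarge p hp).two_le)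
  have hAE : A' * E = 1 := by
    rw [hA', hE, ← Finset.prod_mul_distrib]
    exact Finset.prod_eq_one fun p hp => artinFactor_mul_ramified (hlarge p hp).two_le
  have hcA : c ≤ cQ * A' := by
    have hdisj : Disjoint Q (n.primeFactors.filter fun p => ¬ p ≤ y) := by
      refine Finset.disjoint_left.2 fun q hq hq' => (Finset.mem_filter.1 hq').2 ?_
      have := Finset.mem_range.1 (Finset.mem_filter.1 hq).1
      omega
    rw [hcQ, hA', ← Finset.prod_union hdisj]
    refine artinConstant_le_prod fun q hq => ?_
    rcases Finset.mem_union.1 hq with h | h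
    exacts [hQp q h, hlarge q h]
  have hE1 : 1 ≤ E := by nlinarith
  have hcE : c * E ≤ cQ := by
    calc c * E ≤ cQ * A' * E := mul_le_mul_of_nonneg_right hcA (by linarith)
      _ = cQ := by rw [mul_assoc, hAE, mul_one]
  have hmain : mainTerm (coprimePart k n) n / n = D * (c * E / cQ) := by
    rw [mainTerm_div _ hn rfl, primeFactors_coprimePart hk,
      ← Finset.prod_filter_mul_prod_filter_not n.primeFactors (fun p => p ≤ y)]
    have hn' : n.primeFactors.filter (fun p => p ≤ y) = Q.filter fun q => q ∣ n := by
      ext q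
      simp only [hQ, Finset.mem_filter, Nat.mem_primeFactors, Finset.mem_range]
      exact ⟨fun h => ⟨⟨by omega, h.1.1⟩, h.1.2.1⟩, fun h => ⟨⟨h.1.2, h.2, hn.ne'⟩, by omega⟩⟩
    have hk' : k.primeFactors.filter (fun q => ¬ q ∣ n) = Q.filter fun q => q ∣ k ∧ ¬ q ∣ n := by
      ext q
      simp only [hQ, Finset.mem_filter, Nat.mem_primeFactors, Finset.mem_range]
      constructor
      · rintro ⟨⟨hq, hqk, hk0⟩, hqn⟩
        have := Nat.le_of_dvd (Nat.pos_of_ne_zero hk0) hqk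
        exact ⟨⟨by omega, hq⟩, hqk, hqn⟩
      · rintro ⟨⟨-, hq⟩, hqk, hqn⟩
        exact ⟨⟨hq, hqk, hk.ne_zero⟩, hqn⟩
    have hDe : D = cQ * (∏ q ∈ Q with q ∣ n, B q) * ∏ q ∈ Q with q ∣ k ∧ ¬ q ∣ n,
        (1 - ((q : ℝ) - 1) / ((q : ℝ) ^ 2 - q - 1)) := by
      have e1 : ∏ q ∈ Q with q ∣ n, B q = ∏ q ∈ Q, if q ∣ n then B q else 1 :=
        Finset.prod_filter _ _
      have e2 : ∏ q ∈ Q with q ∣ k ∧ ¬ q ∣ n, (1 - ((q : ℝ) - 1) / ((q : ℝ) ^ 2 - q - 1)) =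
          ∏ q ∈ Q, if q ∣ k ∧ ¬ q ∣ n then 1 - ((q : ℝ) - 1) / ((q : ℝ) ^ 2 - q - 1) else 1 :=
        Finset.prod_filter _ _
      rw [e1, e2, hcQ, ← Finset.prod_mul_distrib, ← Finset.prod_mul_distrib]
      exact Finset.prod_congr rfl fun q hq => one_sub_classDensity_sieveModulus (hQp q hq)
    rw [hn', hk', hDe]
    change c * ((∏ q ∈ Q with q ∣ n, B q) * E) * _ = _
    generalize ∏ q ∈ Q with q ∣ n, B q = X
    generalize ∏ q ∈ Q with q ∣ k ∧ ¬ q ∣ n, (1 - ((q : ℝ) - 1) / ((q : ℝ) ^ 2 - q - 1)) = Y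
    field_simp
  have hr1 : c * E / cQ ≤ 1 := (div_le_one hcQ0).2 hcE
  have hr0 : c / cQ ≤ c * E / cQ :=
    div_le_div_of_nonneg_right (le_mul_of_one_le_right hc0.le hE1) hcQ0.le
  have hr2 : 1 - c / cQ ≤ (cQ - c) / c := by
    have : 1 - c / cQ = (cQ - c) / cQ := by field_simp
    rw [this]
    exact div_le_div_of_nonneg_left (sub_nonneg.2 hccQ) hc0 hccQ
  rw [hmain, abs_sub_comm, abs_of_nonneg (by nlinarith)]
  nlinarith

/-! ### The limit, the uniform lower bound and the conclusion. -/

open Topology in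
theorem tendsto_primeSquarefreeCount_sub_mainTerm {k : ℕ} (hk : Squarefree k) :
    Tendsto (fun n : ℕ => primeSquarefreeCount k n / (n : ℝ) -
      mainTerm (coprimePart k n) n / (n : ℝ)) atTop (𝓝 0) := by
  rw [Metric.tendsto_nhds]
  intro ε hε
  have hc0 := artinConstant_pos
  obtain ⟨y₀, hy₀⟩ := exists_sum_largeModuli_tailWeight_lt (by positivity : 0 < ε / 4)
  have hprod : Tendsto (fun y : ℕ => (∏ q ∈ (Finset.range (y + 1)).filter Nat.Prime, artinFactor q -
      artinConstant) / artinConstant) atTop (𝓝 0) := by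
    simpa using (tendsto_prod_artinFactor.sub_const artinConstant).div_const artinConstant
  -- The level `y` is fixed before `n → ∞`. It controls the tail weights and the truncation of
  -- Artin's product; the sieve error and `log n / n` take the other two quarters of `ε`.
  obtain ⟨y, hy1, hy2⟩ := ((hprod.eventually_lt_const (by positivity : 0 < ε / 4)).and
    (eventually_ge_atTop (max y₀ (max k 2)))).exists
  have hyy : y₀ ≤ y := (le_max_left _ _).trans hy2
  have hyk : k ≤ y := (le_max_left _ _).trans ((le_max_right _ _).trans hy2)
  have hyt : 2 ≤ y := (le_max_right _ _).trans ((le_max_right _ _).trans hy2)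
  set Q := (Finset.range (y + 1)).filter Nat.Prime with hQ
  have hQp : ∀ q ∈ Q, q.Prime := fun q hq => (Finset.mem_filter.1 hq).2
  have hsieve := tendsto_sievedLogSum_sub (Q := Q) (m := sieveModulus k)
    (fun q hq => (sieveModulus_pos (hQp q hq)).ne') (fun i hi j hj hij => by
      have := (Nat.coprime_primes (hQp i hi) (hQp j hj)).2 hij
      simp only [sieveModulus]
      split_ifs
      exacts [this, this.pow_right 2, this.pow_left 2, this.pow 2 2])
  have hlog : Tendsto (fun n : ℕ => Real.log n / (n : ℝ)) atTop (𝓝 0) :=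
    (Real.isLittleO_log_id_atTop.tendsto_div_nhds_zero).comp tendsto_natCast_atTop_atTop
  filter_upwards [Metric.tendsto_nhds.1 hsieve (ε / 4) (by positivity),
    hlog.eventually_lt_const (by positivity : 0 < ε / 4), eventually_gt_atTop 0] with n h1 h2 hn
  have hn0 : (0 : ℝ) < n := by exact_mod_cast hn
  rw [Real.dist_eq, sub_zero] at h1 ⊢
  have h3 := abs_mainTerm_sub_prod_le hk hyk hn
  obtain ⟨h4, h5⟩ := sievedLogSum_sub_primeSquarefreeCount hk.ne_zero hyk hyt n
  have h6 := h5.trans (sum_largeModuli_le y hn.ne')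
  have h7 : (sievedLogSum Q (sieveModulus k) n - primeSquarefreeCount k n) / n ≤
      ∑ q ∈ largeModuli y n, tailWeight q + Real.log n / n := by
    rw [div_le_iff₀ hn0, add_mul, div_mul_cancel₀ _ hn0.ne', mul_comm _ (n : ℝ)]
    exact h6
  have h8 : 0 ≤ (sievedLogSum Q (sieveModulus k) n - primeSquarefreeCount k n) / n :=
    div_nonneg h4 hn0.le
  have h9 := hy₀ y hyy n
  rw [sub_div] at h7 h8
  have h10 := h3.trans_lt hy1
  rw [abs_lt] at h1 h10 ⊢
  constructor <;> linarith

/-- A positive lower bound for the normalised main term, uniform in `n`. -/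
noncomputable def mainTermLowerBound (k : ℕ) : ℝ :=
  artinConstant * ∏ q ∈ k.primeFactors.erase 2, (1 - ((q : ℝ) - 1) / ((q : ℝ) ^ 2 - q - 1))

/-- At `q = 2` this factor is `0`, which is why `2` is erased from the lower bound. -/
theorem excludedFactor_mem {q : ℕ} (hq : 3 ≤ q) :
    0 < 1 - ((q : ℝ) - 1) / ((q : ℝ) ^ 2 - q - 1) ∧
      1 - ((q : ℝ) - 1) / ((q : ℝ) ^ 2 - q - 1) ≤ 1 := by
  have h : (3 : ℝ) ≤ q := by exact_mod_cast hq
  have h1 : 0 < (q : ℝ) ^ 2 - q - 1 := by nlinarith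
  constructor
  · rw [sub_pos, div_lt_one h1]; nlinarith
  · have : 0 ≤ ((q : ℝ) - 1) / ((q : ℝ) ^ 2 - q - 1) := div_nonneg (by linarith) h1.le
    linarith

theorem three_le_of_mem_erase {k q : ℕ} (hq : q ∈ k.primeFactors.erase 2) : 3 ≤ q := by
  rw [Finset.mem_erase] at hq
  have := (Nat.prime_of_mem_primeFactors hq.2).two_le
  omega

theorem mainTermLowerBound_pos (k : ℕ) : 0 < mainTermLowerBound k :=
  mul_pos artinConstant_pos (Finset.prod_pos fun _ hq =>
    (excludedFactor_mem (three_le_of_mem_erase hq)).1)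

/-- The parity hypothesis keeps `2` out of `coprimePart k n`. The factors at `p ∣ n` are at least
`1`, and enlarging the other product to all odd primes dividing `k` only lowers it. -/
theorem mainTermLowerBound_le {k n : ℕ} (hk : Squarefree k) (hkn : Odd k ∨ Even n) :
    mainTermLowerBound k ≤
      artinConstant * (∏ p ∈ n.primeFactors, (1 + 1 / ((p : ℝ) ^ 2 - p - 1))) *
        ∏ q ∈ (coprimePart k n).primeFactors,
          (1 - ((q : ℝ) - 1) / ((q : ℝ) ^ 2 - q - 1)) := by
  have hsub : (coprimePart k n).primeFactors ⊆ k.primeFactors.erase 2 := by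
    intro q hq
    rw [primeFactors_coprimePart hk, Finset.mem_filter] at hq
    refine Finset.mem_erase.2 ⟨?_, hq.1⟩
    rintro rfl
    rcases hkn with h | h
    · exact (Nat.not_even_iff_odd.2 h) (even_iff_two_dvd.2 (Nat.dvd_of_mem_primeFactors hq.1))
    · exact hq.2 h.two_dvd
  have hP : 1 ≤ ∏ p ∈ n.primeFactors, (1 + 1 / ((p : ℝ) ^ 2 - p - 1)) := by
    refine (Finset.prod_const_one (s := n.primeFactors)).symm.le.trans
      (Finset.prod_le_prod (fun _ _ => zero_le_one) fun p hp => ?_)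
    have h : (2 : ℝ) ≤ p := by exact_mod_cast (Nat.prime_of_mem_primeFactors hp).two_le
    have : 0 ≤ 1 / ((p : ℝ) ^ 2 - p - 1) := one_div_nonneg.2 (by nlinarith)
    linarith
  have hX : ∏ q ∈ k.primeFactors.erase 2, (1 - ((q : ℝ) - 1) / ((q : ℝ) ^ 2 - q - 1)) ≤
      ∏ q ∈ (coprimePart k n).primeFactors, (1 - ((q : ℝ) - 1) / ((q : ℝ) ^ 2 - q - 1)) := by
    rw [← Finset.prod_sdiff hsub]
    refine mul_le_of_le_one_left (Finset.prod_nonneg fun q hq =>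
      (excludedFactor_mem (three_le_of_mem_erase (hsub hq))).1.le)
      (Finset.prod_le_one (fun q hq => ?_) fun q hq => ?_)
    · exact (excludedFactor_mem (three_le_of_mem_erase (Finset.sdiff_subset hq))).1.le
    · exact (excludedFactor_mem (three_le_of_mem_erase (Finset.sdiff_subset hq))).2
  have hX0 : 0 ≤ ∏ q ∈ k.primeFactors.erase 2, (1 - ((q : ℝ) - 1) / ((q : ℝ) ^ 2 - q - 1)) :=
    Finset.prod_nonneg fun q hq => (excludedFactor_mem (three_le_of_mem_erase hq)).1.le
  rw [mainTermLowerBound]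
  exact mul_le_mul (le_mul_of_one_le_right artinConstant_pos.le hP) hX hX0
    (mul_nonneg artinConstant_pos.le (zero_le_one.trans hP))

-- The main term oscillates with `n` and need not converge, so a lower bound by a positive constant
-- takes the place of a nonzero limit.
open Topology in
theorem isEquivalent_of_tendsto_sub {ι : Type*} {l : Filter ι} {u v : ι → ℝ} {δ : ℝ} (hδ : 0 < δ)
    (h : Tendsto (fun i => u i - v i) l (𝓝 0)) (hv : ∀ᶠ i in l, δ ≤ v i) : u ~[l] v := by
  have h1 : (u - v) =o[l] fun _ => (1 : ℝ) := (isLittleO_one_iff ℝ).2 h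
  refine h1.trans_isBigO (IsBigO.of_bound δ⁻¹ ?_)
  filter_upwards [hv] with i hi
  rw [norm_one, Real.norm_of_nonneg (hδ.le.trans hi), inv_mul_eq_div, one_le_div hδ]
  exact hi

theorem exists_primeSquarefreeCount_pos {k : ℕ} (hk : Squarefree k) :
    ∃ N : ℕ, 0 < N ∧ ∀ n : ℕ, Odd k ∨ Even n → N < n → 0 < primeSquarefreeCount k n := by
  have hδ := mainTermLowerBound_pos k
  obtain ⟨N, hN⟩ := eventually_atTop.1 (Metric.tendsto_nhds.1
    (tendsto_primeSquarefreeCount_sub_mainTerm hk) _ hδ)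
  refine ⟨N + 1, N.succ_pos, fun n hkn hn => ?_⟩
  have hn0 : 0 < n := by omega
  have h1 := hN n (by omega)
  rw [Real.dist_eq, sub_zero, abs_lt, mainTerm_div _ hn0 rfl] at h1
  have h2 := mainTermLowerBound_le hk hkn
  have h3 : 0 < primeSquarefreeCount k n / (n : ℝ) := by linarith [h1.1]
  exact (div_pos_iff_of_pos_right (by exact_mod_cast hn0)).1 h3

theorem theorem4p1 (k : ℕ) (hk : Squarefree k) :
    (Odd k →
      (fun n : ℕ => primeSquarefreeCount k n / (n : ℝ)) ~[atTop]
          (fun n : ℕ => mainTerm (coprimePart k n) n / (n : ℝ)) ∧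
      (∀ n : ℕ, 0 < n →
        mainTerm (coprimePart k n) n / (n : ℝ) =
          artinConstant * (∏ p ∈ n.primeFactors, (1 + 1 / ((p : ℝ) ^ 2 - p - 1))) *
            ∏ q ∈ (coprimePart k n).primeFactors,
              (1 - ((q : ℝ) - 1) / ((q : ℝ) ^ 2 - q - 1)) ∧
        0 < artinConstant * (∏ p ∈ n.primeFactors, (1 + 1 / ((p : ℝ) ^ 2 - p - 1))) *
            ∏ q ∈ (coprimePart k n).primeFactors,
              (1 - ((q : ℝ) - 1) / ((q : ℝ) ^ 2 - q - 1))) ∧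
      ∃ N : ℕ, 0 < N ∧ ∀ n : ℕ, N < n → 0 < primeSquarefreeCount k n) ∧
    (Even k →
      (fun n : ℕ => primeSquarefreeCount k (2 * n) / (2 * (n : ℝ))) ~[atTop]
          (fun n : ℕ => mainTerm (coprimePart k (2 * n)) (2 * n) / (2 * (n : ℝ))) ∧
      (∀ n : ℕ, 0 < n →
        mainTerm (coprimePart k (2 * n)) (2 * n) / (2 * (n : ℝ)) =
          artinConstant * (∏ p ∈ (2 * n).primeFactors, (1 + 1 / ((p : ℝ) ^ 2 - p - 1))) *
            ∏ q ∈ (coprimePart k (2 * n)).primeFactors,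
              (1 - ((q : ℝ) - 1) / ((q : ℝ) ^ 2 - q - 1)) ∧
        0 < artinConstant * (∏ p ∈ (2 * n).primeFactors, (1 + 1 / ((p : ℝ) ^ 2 - p - 1))) *
            ∏ q ∈ (coprimePart k (2 * n)).primeFactors,
              (1 - ((q : ℝ) - 1) / ((q : ℝ) ^ 2 - q - 1))) ∧
      ∃ N : ℕ, 0 < N ∧ ∀ n : ℕ, Even n → N < n → 0 < primeSquarefreeCount k n) := by

  have hlim := tendsto_primeSquarefreeCount_sub_mainTerm hk
  have hδ := mainTermLowerBound_pos k
  obtain ⟨N, hN0, hN⟩ := exists_primeSquarefreeCount_pos hk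
  refine ⟨fun hodd => ⟨?_, fun n hn => ⟨mainTerm_div _ hn rfl, ?_⟩, N, hN0, fun n => hN n (.inl hodd)⟩,
    fun heven => ⟨?_, fun n hn => ⟨mainTerm_div _ (by omega) (by push_cast; rfl), ?_⟩, N, hN0,
      fun n hn => hN n (.inr hn)⟩⟩
  · refine isEquivalent_of_tendsto_sub hδ hlim ?_
    filter_upwards [eventually_gt_atTop 0] with n hn
    rw [mainTerm_div _ hn rfl]
    exact mainTermLowerBound_le hk (.inl hodd)
  · exact hδ.trans_le (mainTermLowerBound_le hk (.inl hodd))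
  · have h2 : Tendsto (fun n : ℕ => 2 * n) atTop atTop :=
      tendsto_id.const_mul_atTop' two_pos
    refine isEquivalent_of_tendsto_sub hδ ((hlim.comp h2).congr fun n => ?_) ?_
    · simp only [Function.comp_apply]; push_cast; rfl
    · filter_upwards [eventually_gt_atTop 0] with n hn
      rw [mainTerm_div _ (by omega) (by push_cast; rfl)]
      exact mainTermLowerBound_le hk (.inr (even_two_mul n))
  · exact hδ.trans_le (mainTermLowerBound_le hk (.inr (even_two_mul n)))
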